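/- **Conventions.** A *Riesz space* is a real vector space with a lattice order compatible with the linear structure; $U^+=\{u\ge 0\}$ and $|u|=u\vee(-u)$. A *Riesz subspace* is a linear subspace that is a sublattice; it is *solid* if it contains every $v$ with $|v|\le|u|$ for some $u$ in it. A partially ordered set is *Dedekind $\sigma$-complete* if each non-empty countable subset that is bounded above (below) has a supremum (infimum). An order-preserving map is *$\sigma$-order-continuous* if it preserves existing suprema of non-decreasing sequences and existing infima of non-increasing sequences. An *$f$-algebra* is a Riesz space $U$ with a commutative, associative, bilinear, unital multiplication such that $uv\ge 0$ for $u,v\ge 0$, and $(uw)\wedge v=0$ whenever $u\wedge v=0$ and $w\ge 0$. A finite (countable) *partition* of $1$ is a finite (countable) family of idempotents $u_n$ with $|u_n|\wedge|u_m|=0$ for $n\ne m$ and sum (supremum) equal to $1$. *Simple elements* are the elements $\sum_i\lambda_iu_i$ with $\lambda_i\in\mathbb R$ and $(u_i)$ a finite partition of $1$. The $f$-algebra $U$ is *localisable* if it is Dedekind $\sigma$-complete, its multiplication is $\sigma$-order-continuous on $U^+\times U^+$, and each $u\in U^+$ is the supremum of a non-decreasing sequence of non-negative simple elements. A *metric Riesz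 space* is a Dedekind $\sigma$-complete Riesz space $V$ with a complete translation-invariant distance $d_V$ such that $d_V(v,0)=d_V(|v|,0)$ for all $v\in V$, and $d_V(v,0)\le d_V(w,0)$ if $0\le v\le w$. A *metric $f$-algebra* is a localisable $f$-algebra $U$ with a distance $d_U$ making it a metric Riesz space, with continuous multiplication, dense simple elements, and $d_U(\varepsilon 1,0)\to0$ as $\varepsilon\searrow0$. A *metric $f$-structure* is a triple $(\mathcal U,U,V)$ where $\mathcal U$ is a localisable $f$-algebra; $U\subset\mathcal U$ is a solid unital sub-$f$-algebra that is a metric $f$-algebra; $V\subset\mathcal U$ is a solid Riesz subspace that is a metric Riesz space; $UV=V$ and multiplication $U\times V\to V$ is continuous; and for every countable partition $(u_n)$ of $1$ in $U$ and every $\varepsilon>0$ there is $\delta>0$ such that, whenever $(v_n)\subset V^+$ and $\sum_nd_V(u_nv_n,0)\le\delta$, the sequence $(u_nv_n)$ is order-bounded in $V$ and $d_V(\sup_nu_nv_n,0)\le\varepsilon$. A *$V$-Banach $U$-module* is a $U$-module $\mathscr M$ with a map $|\cdot|\colon\mathscr M\to V^+$ such that (a) $|v|=0\iff v=0$, $|v+w|\le|v|+|w|$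 and $|u\cdot v|=|u||v|$; (b) (glueing) for each countable partition $(u_n)$ of $1$ in $U$ and $(v_n)\subset\mathscr M$ with $(|u_n\cdot v_n|)$ order-bounded in $V$ there is $v\in\mathscr M$ (written $\sum_nu_n\cdot v_n$) with $u_n\cdot v=u_n\cdot v_n$ for all $n$; (c) $\mathscr M$ is complete for $d_{\mathscr M}(v,w)=d_V(|v-w|,0)$. For $S\subset\mathscr M$, let $\mathscr G(S)$ be the set of all such elements $\sum_nu_n\cdot v_n$ with $v_n\in S$. Each such $\mathscr M$ is a real vector space via $\lambda v=(\lambda 1)\cdot v$. **Statement.** Let $(\mathcal U,U,V)$ be a metric $f$-structure, $\mathscr V$ a real vector space, and $\psi\colon\mathscr V\to V^+$ a map with $\psi(\lambda x)=\lambda\psi(x)$ for $\lambda\ge0$, $\psi(x+y)\le\psi(x)+\psi(y)$ and $\psi(-x)=\psi(x)$. Let $\mathbf C_\psi$ be the category whose objects are the pairs $(\mathscr M,T)$ with $\mathscr M$ a $V$-Banach $U$-module and $T\colon\mathscr V\to\mathscr M$ a linear map with $|Tx|\le\psi(x)$ for all $x\in\mathscr V$, and whose morphisms $(\mathscr M_1,T_1)\to(\mathscr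 M_2,T_2)$ are the $U$-linear maps $\Phi\colon\mathscr M_1\to\mathscr M_2$ with $|\Phi v|\le|v|$ for all $v\in\mathscr M_1$ and $\Phi\circ T_1=T_2$. There exists a pair $(\mathscr M_{\langle\psi\rangle},T_{\langle\psi\rangle})$, consisting of a $V$-Banach $U$-module and a linear map $T_{\langle\psi\rangle}\colon\mathscr V\to\mathscr M_{\langle\psi\rangle}$, such that 1. $|T_{\langle\psi\rangle}x|=\psi(x)$ for every $x\in\mathscr V$; 2. $\mathscr G(T_{\langle\psi\rangle}(\mathscr V))$ is dense in $\mathscr M_{\langle\psi\rangle}$; and every pair with these two properties is an initial object of $\mathbf C_\psi$: for each object $(\mathscr M,T)$ of $\mathbf C_\psi$ there is a unique morphism $(\mathscr M_{\langle\psi\rangle},T_{\langle\psi\rangle})\to(\mathscr M,T)$. -/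

import Mathlib

open CategoryTheory

universe u v w

/-! ### Order-theoretic notions -/

/-- Every non-empty countable set with an upper (resp. lower) bound has a supremum
(resp. an infimum). -/
structure DedekindSigmaComplete (P : Type u) [PartialOrder P] : Prop where
  exists_sup : ∀ s : Set P, s.Nonempty → s.Countable → BddAbove s → ∃ a, IsLUB s a
  exists_inf : ∀ s : Set P, s.Nonempty → s.Countable → BddBelow s → ∃ a, IsGLB s a

/-- An order-preserving map that preserves suprema of non-decreasing sequences and infima of
non-increasing sequences, whenever they exist. -/
structure SigmaOrderContinuous {P : Type u} {Q : Type v} [PartialOrder P] [PartialOrder Q]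
    (f : P → Q) : Prop where
  monotone : Monotone f
  sup : ∀ (p : ℕ → P) (a : P), Monotone p → IsLUB (Set.range p) a →
    IsLUB (Set.range fun n => f (p n)) (f a)
  inf : ∀ (p : ℕ → P) (a : P), Antitone p → IsGLB (Set.range p) a →
    IsGLB (Set.range fun n => f (p n)) (f a)

/-- A set that is bounded both from above and from below. -/
def OrderBounded {P : Type u} [PartialOrder P] (s : Set P) : Prop :=
  BddAbove s ∧ BddBelow s

/-! ### `f`-algebras -/

/-- A (commutative, unital) `f`-algebra: a Riesz space over `ℝ` with a compatible
multiplication. -/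
class FAlgebra (A : Type u) [CommRing A] [Algebra ℝ A] [Lattice A] : Prop
    extends IsOrderedAddMonoid A, PosSMulMono ℝ A where
  mul_nonneg : ∀ a b : A, 0 ≤ a → 0 ≤ b → 0 ≤ a * b
  mul_inf_eq_zero : ∀ a b c : A, a ⊓ b = 0 → 0 ≤ c → (a * c) ⊓ b = 0

/-- `(p i)` is a finite partition of `a`: disjoint idempotents with sum `a`. -/
structure IsFinitePartition {A : Type u} [CommRing A] [Lattice A] {n : ℕ}
    (p : Fin n → A) (a : A) : Prop where
  idem : ∀ i, IsIdempotentElem (p i)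
  disjoint : ∀ i j, i ≠ j → |p i| ⊓ |p j| = 0
  sum_eq : ∑ i, p i = a

/-- `(p n)` is a countable partition of `a`: disjoint idempotents with supremum `a`. -/
structure IsCountablePartition {A : Type u} [CommRing A] [Lattice A]
    (p : ℕ → A) (a : A) : Prop where
  idem : ∀ n, IsIdempotentElem (p n)
  disjoint : ∀ n m, n ≠ m → |p n| ⊓ |p m| = 0
  isLUB : IsLUB (Set.range p) a

/-- Simple elements: linear combinations of the elements of a finite partition of `1`. -/
def simpleElements (A : Type u) [CommRing A] [Algebra ℝ A] [Lattice A] : Set A :=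
  {a | ∃ (n : ℕ) (c : Fin n → ℝ) (p : Fin n → A), IsFinitePartition p 1 ∧ a = ∑ i, c i • p i}

/-- Localisable `f`-algebras. -/
class LocalisableFAlgebra (A : Type u) [CommRing A] [Algebra ℝ A] [Lattice A] : Prop
    extends FAlgebra A where
  sigmaComplete : DedekindSigmaComplete A
  mul_sigmaOrderContinuous :
    SigmaOrderContinuous fun p : {a : A // 0 ≤ a} × {a : A // 0 ≤ a} => (p.1 : A) * (p.2 : A)
  simple_superOrderDense : ∀ a : A, 0 ≤ a → ∃ s : ℕ → A, Monotone s ∧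
    (∀ n, s n ∈ simpleElements A ∧ 0 ≤ s n) ∧ IsLUB (Set.range s) a

/-! ### Metric Riesz spaces and metric `f`-algebras -/

/-- Metric Riesz spaces: Dedekind `σ`-complete Riesz spaces with a compatible complete
distance. -/
class MetricRieszSpace (E : Type u) [AddCommGroup E] [Module ℝ E] [Lattice E] [MetricSpace E] :
    Prop extends IsOrderedAddMonoid E, PosSMulMono ℝ E, CompleteSpace E where
  sigma_complete : DedekindSigmaComplete E
  dist_abs : ∀ a : E, dist a 0 = dist |a| 0
  dist_translation : ∀ a b c : E, dist a b = dist (a + c) (b + c)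
  dist_mono : ∀ a b : E, 0 ≤ a → a ≤ b → dist a 0 ≤ dist b 0

/-- Metric `f`-algebras. -/
class MetricFAlgebra (A : Type u) [CommRing A] [Algebra ℝ A] [Lattice A] [MetricSpace A] :
    Prop extends LocalisableFAlgebra A, MetricRieszSpace A where
  continuous_mul : Continuous fun p : A × A => p.1 * p.2
  dense_simple : Dense (simpleElements A)
  tendsto_smul_one : Filter.Tendsto (fun ε : ℝ => dist (ε • (1 : A)) 0)
    (nhdsWithin 0 (Set.Ioi 0)) (nhds 0)

/-! ### Solid subspaces and subalgebras -/

/-- Solid Riesz subspaces: linear subspaces that are sublattices and are solid. -/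
structure SolidRieszSubspace (E : Type u) [AddCommGroup E] [Module ℝ E] [Lattice E]
    extends Submodule ℝ E where
  sup_mem' : ∀ a ∈ toSubmodule, ∀ b ∈ toSubmodule, a ⊔ b ∈ toSubmodule
  inf_mem' : ∀ a ∈ toSubmodule, ∀ b ∈ toSubmodule, a ⊓ b ∈ toSubmodule
  solid' : ∀ a : E, ∀ b ∈ toSubmodule, |a| ≤ |b| → a ∈ toSubmodule

/-- Solid `f`-subalgebras: unital subalgebras that are sublattices and are solid. -/
structure SolidFSubalgebra (A : Type u) [CommRing A] [Algebra ℝ A] [Lattice A]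
    extends Subalgebra ℝ A where
  sup_mem' : ∀ a ∈ toSubalgebra, ∀ b ∈ toSubalgebra, a ⊔ b ∈ toSubalgebra
  inf_mem' : ∀ a ∈ toSubalgebra, ∀ b ∈ toSubalgebra, a ⊓ b ∈ toSubalgebra
  solid' : ∀ a : A, ∀ b ∈ toSubalgebra, |a| ≤ |b| → a ∈ toSubalgebra

instance {E : Type u} [AddCommGroup E] [Module ℝ E] [Lattice E] :
    CoeSort (SolidRieszSubspace E) (Type u) := ⟨fun V => V.toSubmodule⟩

instance {A : Type u} [CommRing A] [Algebra ℝ A] [Lattice A] :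
    CoeSort (SolidFSubalgebra A) (Type u) := ⟨fun U => U.toSubalgebra⟩

/-- The lattice structure induced from the ambient space. -/
instance SolidRieszSubspace.instLattice {E : Type u} [AddCommGroup E] [Module ℝ E] [Lattice E]
    (V : SolidRieszSubspace E) : Lattice V :=
  Subtype.lattice (fun a b ha hb => V.sup_mem' a ha b hb) (fun a b ha hb => V.inf_mem' a ha b hb)

/-- The lattice structure induced from the ambient algebra. -/
instance SolidFSubalgebra.instLattice {A : Type u} [CommRing A] [Algebra ℝ A] [Lattice A]
    (U : SolidFSubalgebra A) : Lattice U :=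
  Subtype.lattice (fun a b ha hb => U.sup_mem' a ha b hb) (fun a b ha hb => U.inf_mem' a ha b hb)

/-! ### Metric `f`-structures -/

/-- A metric `f`-structure `(𝒰, U, V)` on the localisable `f`-algebra `𝒰`. -/
structure MetricFStructure (𝒰 : Type u) [CommRing 𝒰] [Algebra ℝ 𝒰] [Lattice 𝒰]
    [LocalisableFAlgebra 𝒰] where
  U : SolidFSubalgebra 𝒰
  V : SolidRieszSubspace 𝒰
  [metricU : MetricSpace U]
  [metricV : MetricSpace V]
  [metricFAlgebra : MetricFAlgebra U]
  [metricRieszSpace : MetricRieszSpace V]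
  /-- `U V = V`. -/
  image_mul : Set.image2 (fun a b : 𝒰 => a * b) (U.toSubalgebra : Set 𝒰)
    (V.toSubmodule : Set 𝒰) = (V.toSubmodule : Set 𝒰)
  /-- The multiplication is continuous from `U × V` to `V`. -/
  continuous_mul : Continuous fun p : U × V =>
    (⟨(p.1 : 𝒰) * (p.2 : 𝒰), image_mul.subset (Set.mem_image2_of_mem p.1.2 p.2.2)⟩ : V)
  /-- The compatibility of `V` with countable partitions of `1`. -/
  exists_delta : ∀ p : ℕ → U, IsCountablePartition p 1 → ∀ ε : ℝ, 0 < ε → ∃ δ : ℝ, 0 < δ ∧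
    ∀ x y : ℕ → V, (∀ n, 0 ≤ x n) → (∀ n, (y n : 𝒰) = (p n : 𝒰) * (x n : 𝒰)) →
      Summable (fun n => dist (y n) 0) → ∑' n, dist (y n) 0 ≤ δ →
        OrderBounded (Set.range y) ∧ ∃ s : V, IsLUB (Set.range y) s ∧ dist s 0 ≤ ε

attribute [instance] MetricFStructure.metricU MetricFStructure.metricV
  MetricFStructure.metricFAlgebra MetricFStructure.metricRieszSpace

/-! ### Normed and Banach modules -/

/-- A `V`-normed `U`-module structure on the `U`-module `M`. -/
structure VNorm {𝒰 : Type u} [CommRing 𝒰] [Algebra ℝ 𝒰] [Lattice 𝒰] [LocalisableFAlgebra 𝒰]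
    (S : MetricFStructure 𝒰) (M : Type w) [AddCommGroup M] [Module S.U M] where
  /-- The pointwise norm. -/
  toFun : M → S.V
  nonneg : ∀ x, 0 ≤ toFun x
  eq_zero_iff : ∀ x, toFun x = 0 ↔ x = 0
  add_le : ∀ x y, toFun (x + y) ≤ toFun x + toFun y
  smul_eq : ∀ (a : S.U) (x : M), (toFun (a • x) : 𝒰) = |(a : 𝒰)| * (toFun x : 𝒰)
  /-- The glueing property. -/
  glueing : ∀ p : ℕ → S.U, IsCountablePartition p 1 → ∀ x : ℕ → M,
    OrderBounded (Set.range fun n => toFun (p n • x n)) → ∃ y : M, ∀ n, p n • y = p n • x n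

/-- The distance `d(x, y) = d_V(|x - y|, 0)` of a `V`-normed `U`-module. -/
@[reducible]
def VNorm.metricSpace {𝒰 : Type u} [CommRing 𝒰] [Algebra ℝ 𝒰] [Lattice 𝒰]
    [LocalisableFAlgebra 𝒰] {S : MetricFStructure 𝒰} {M : Type w} [AddCommGroup M]
    [Module S.U M] (N : VNorm S M) : MetricSpace M where
  dist x y := dist (N.toFun (x - y)) 0
  dist_self x := by
    show dist (N.toFun (x - x)) 0 = 0
    rw [sub_self, (N.eq_zero_iff 0).2 rfl, dist_self]
  dist_comm x y := by
    show dist (N.toFun (x - y)) 0 = dist (N.toFun (y - x)) 0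
    have h : N.toFun (x - y) = N.toFun (y - x) := by
      apply Subtype.ext
      have h1 := N.smul_eq (-1) (y - x)
      have h2 := N.smul_eq 1 (y - x)
      rw [neg_one_smul, neg_sub] at h1
      rw [one_smul] at h2
      rw [h1, NegMemClass.coe_neg, abs_neg, ← h2]
    rw [h]
  dist_triangle x y z := by
    show dist (N.toFun (x - z)) 0 ≤ dist (N.toFun (x - y)) 0 + dist (N.toFun (y - z)) 0
    have h1 : N.toFun (x - z) ≤ N.toFun (x - y) + N.toFun (y - z) := by
      simpa using N.add_le (x - y) (y - z)
    have h2 := MetricRieszSpace.dist_mono _ _ (N.nonneg (x - z)) h1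
    have h3 := dist_triangle (N.toFun (x - y) + N.toFun (y - z)) (N.toFun (y - z)) 0
    have h4 := MetricRieszSpace.dist_translation (N.toFun (x - y)) 0 (N.toFun (y - z))
    rw [zero_add] at h4
    linarith
  eq_of_dist_eq_zero {x y} h := by
    have h' : dist (N.toFun (x - y)) 0 = 0 := h
    exact sub_eq_zero.1 ((N.eq_zero_iff _).1 (dist_eq_zero.1 h'))

/-- `V`-Banach `U`-modules (with underlying set in `Type w`). -/
structure BanMod {𝒰 : Type u} [CommRing 𝒰] [Algebra ℝ 𝒰] [Lattice 𝒰] [LocalisableFAlgebra 𝒰]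
    (S : MetricFStructure 𝒰) where
  carrier : Type w
  [addCommGroup : AddCommGroup carrier]
  [module : Module S.U carrier]
  /-- The pointwise norm. -/
  norm : VNorm S carrier
  complete : @CompleteSpace carrier norm.metricSpace.toUniformSpace

namespace BanMod

instance {𝒰 : Type u} [CommRing 𝒰] [Algebra ℝ 𝒰] [Lattice 𝒰] [LocalisableFAlgebra 𝒰]
    {S : MetricFStructure 𝒰} : CoeSort (BanMod.{u, w} S) (Type w) := ⟨BanMod.carrier⟩

attribute [instance] BanMod.addCommGroup BanMod.module

instance instMetricSpace {𝒰 : Type u} [CommRing 𝒰] [Algebra ℝ 𝒰] [Lattice 𝒰]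
    [LocalisableFAlgebra 𝒰] {S : MetricFStructure 𝒰} (M : BanMod.{u, w} S) : MetricSpace M :=
  M.norm.metricSpace

/-- The pointwise norm `|x|` of an element of a `V`-Banach `U`-module. -/
def pnorm {𝒰 : Type u} [CommRing 𝒰] [Algebra ℝ 𝒰] [Lattice 𝒰] [LocalisableFAlgebra 𝒰]
    {S : MetricFStructure 𝒰} (M : BanMod.{u, w} S) (x : M) : S.V :=
  M.norm.toFun x

/-- The set `𝒢(s)` of all elements `∑ pₙ • xₙ` obtained by glueing together elements of `s`. -/
def glued {𝒰 : Type u} [CommRing 𝒰] [Algebra ℝ 𝒰] [Lattice 𝒰] [LocalisableFAlgebra 𝒰]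
    {S : MetricFStructure 𝒰} (M : BanMod.{u, w} S) (s : Set M) : Set M :=
  {y | ∃ (p : ℕ → S.U) (x : ℕ → M), IsCountablePartition p 1 ∧ (∀ n, x n ∈ s) ∧
    OrderBounded (Set.range fun n => M.pnorm (p n • x n)) ∧ ∀ n, p n • y = p n • x n}

/-- Morphisms of `V`-Banach `U`-modules: `U`-linear maps `Φ` with `|Φ x| ≤ |x|`. -/
@[ext]
structure Hom {𝒰 : Type u} [CommRing 𝒰] [Algebra ℝ 𝒰] [Lattice 𝒰] [LocalisableFAlgebra 𝒰]
    {S : MetricFStructure 𝒰} (M N : BanMod.{u, w} S) where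
  toLinearMap : M →ₗ[S.U] N
  pnorm_le : ∀ x, N.pnorm (toLinearMap x) ≤ M.pnorm x

/-- The category of `V`-Banach `U`-modules. -/
instance instCategory {𝒰 : Type u} [CommRing 𝒰] [Algebra ℝ 𝒰] [Lattice 𝒰]
    [LocalisableFAlgebra 𝒰] {S : MetricFStructure 𝒰} : Category (BanMod.{u, w} S) where
  Hom M N := Hom M N
  id M := ⟨LinearMap.id, fun _ => le_rfl⟩
  comp f g := ⟨g.toLinearMap.comp f.toLinearMap,
    fun x => (g.pnorm_le (f.toLinearMap x)).trans (f.pnorm_le x)⟩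

end BanMod

/-! ### The category `C_ψ` -/

/-- Symmetric sublinear maps `ψ : 𝒱 → V⁺`. -/
structure IsSymmetricSublinear {𝒱 : Type v} [AddCommGroup 𝒱] [Module ℝ 𝒱] {E : Type u}
    [AddCommGroup E] [Module ℝ E] [Lattice E] (ψ : 𝒱 → E) : Prop where
  nonneg : ∀ x, 0 ≤ ψ x
  smul : ∀ (c : ℝ) (x : 𝒱), 0 ≤ c → ψ (c • x) = c • ψ x
  add_le : ∀ x y, ψ (x + y) ≤ ψ x + ψ y
  neg : ∀ x, ψ (-x) = ψ x

/-- Objects `(M, T)` of `C_ψ`. A `U`-module is a real vector space through `ℝ → U`,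
`c ↦ c 1`, so that "`T` is linear" means `T (c x) = (c 1) • T x`. -/
structure CPsi {𝒰 : Type u} [CommRing 𝒰] [Algebra ℝ 𝒰] [Lattice 𝒰] [LocalisableFAlgebra 𝒰]
    (S : MetricFStructure 𝒰) {𝒱 : Type v} [AddCommGroup 𝒱] [Module ℝ 𝒱] (ψ : 𝒱 → S.V) where
  M : BanMod.{u, w} S
  T : 𝒱 →ₛₗ[algebraMap ℝ S.U] M
  pnorm_le : ∀ x, M.pnorm (T x) ≤ ψ x

namespace CPsi

/-- Morphisms of `C_ψ`: morphisms of `V`-Banach `U`-modules that commute with the maps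
from `𝒱`. -/
@[ext]
structure Hom {𝒰 : Type u} [CommRing 𝒰] [Algebra ℝ 𝒰] [Lattice 𝒰] [LocalisableFAlgebra 𝒰]
    {S : MetricFStructure 𝒰} {𝒱 : Type v} [AddCommGroup 𝒱] [Module ℝ 𝒱] {ψ : 𝒱 → S.V}
    (X Y : CPsi.{u, v, w} S ψ) where
  hom : X.M ⟶ Y.M
  comm : ∀ x, BanMod.Hom.toLinearMap hom (X.T x) = Y.T x

/-- The category `C_ψ`. -/
instance instCategory {𝒰 : Type u} [CommRing 𝒰] [Algebra ℝ 𝒰] [Lattice 𝒰]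
    [LocalisableFAlgebra 𝒰] {S : MetricFStructure 𝒰} {𝒱 : Type v} [AddCommGroup 𝒱]
    [Module ℝ 𝒱] {ψ : 𝒱 → S.V} : Category (CPsi.{u, v, w} S ψ) where
  Hom X Y := Hom X Y
  id X := ⟨𝟙 X.M, fun _ => rfl⟩
  comp {X Y Z} f g := ⟨f.hom ≫ g.hom, fun x => by
    show BanMod.Hom.toLinearMap g.hom (BanMod.Hom.toLinearMap f.hom (X.T x)) = Z.T x
    rw [f.comm, g.comm]⟩

/-- `(M, T)` is the couple generated by `ψ`: `|T x| = ψ x` for all `x`, and the elements obtained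
by glueing together elements of the image of `T` are dense in `M`. -/
structure IsGenerated {𝒰 : Type u} [CommRing 𝒰] [Algebra ℝ 𝒰] [Lattice 𝒰]
    [LocalisableFAlgebra 𝒰] {S : MetricFStructure 𝒰} {𝒱 : Type v} [AddCommGroup 𝒱]
    [Module ℝ 𝒱] {ψ : 𝒱 → S.V} (X : CPsi.{u, v, w} S ψ) : Prop where
  pnorm_eq : ∀ x, X.M.pnorm (X.T x) = ψ x
  dense : Dense (X.M.glued (Set.range X.T))

end CPsi

/-! Initiality. On each member of some partition of `1`, an element of 𝒢(T(𝒱)) coincides with some T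
x, so a morphism is determined on 𝒢(T(𝒱)), and by density everywhere. To construct one into (M', T')
with |T' x| ≤ |T x|, glue the pairs (T x, T' x) in the product and take the closure of the resulting
set. The inequality |z| ≤ |y| holds for all (y, z) in this closure, which is a submodule and hence
the graph of a linear map; completeness and glueing in M' make its domain everything
(`exists_extension`, `extension_unique`).

Existence. Put e_(x,n) = x and consider the families t : 𝒱 × ℕ → U with countable support and ∑
|t_i| ψ(e_i) bounded. Their seminorm is the infimum, over finitely supported real families q, of ψ(∑
q_i e_i) + ∑ |t_i - q_i| ψ(e_i). Although V has only countable infima, this one exists, because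
rational q supported in the support of t suffice (`exists_isGLB_upper`). The seminorm is homogeneous
for real numbers and for idempotents, hence for all of U by density of the simple elements
(`seminorm_smul`), and it equals ψ(∑ q_i e_i) on a real family q (`seminorm_real`). In the
completion, the unit vector at (x, n) therefore becomes an element T x that is independent of n and
linear in x, with |T x| = ψ(x). The family with value p_n at (x_n, n) glues the T x_n along the
partition (p_n) (`exists_ambient`).

Glueing is obtained not for the whole completion but for the closure of the glued set: its elements
are approximated by glued ones, with errors made summable so that the axiom relating V to partitions
bounds their supremum (`GluesRange.exists_gluedClosure`). This closure is the required module. -/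

set_option linter.unusedSectionVars false

/-! ### Lattice-ordered groups -/

section LatticeGroup

variable {G : Type u} [AddCommGroup G] [Lattice G] [IsOrderedAddMonoid G]

theorem abs_sub_eq_add_of_inf_eq_zero {a b : G} (h : a ⊓ b = 0) : |a - b| = a + b := by
  have h1 := sup_sub_inf_eq_abs_sub b a
  have h2 := inf_add_sup a b
  rw [inf_comm, h, sub_zero] at h1
  rw [h, zero_add] at h2
  rw [← h1, sup_comm, h2]

theorem add_inf_eq_zero {a b c : G} (ha : a ⊓ c = 0) (hb : b ⊓ c = 0) : (a + b) ⊓ c = 0 := by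
  have ha0 : 0 ≤ a := ha ▸ inf_le_left
  have hb0 : 0 ≤ b := hb ▸ inf_le_left
  have hc0 : 0 ≤ c := ha ▸ inf_le_right
  refine le_antisymm ?_ (le_inf (add_nonneg ha0 hb0) hc0)
  have h1 : (a + b) ⊓ c - a ≤ b ⊓ c := by
    refine le_inf (sub_le_iff_le_add'.2 inf_le_left) ?_
    exact (sub_le_self _ ha0).trans inf_le_right
  rw [hb, sub_nonpos] at h1
  exact (le_inf h1 inf_le_right).trans ha.le

theorem nonneg_iff_abs_eq {a : G} : 0 ≤ a ↔ |a| = a :=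
  ⟨abs_of_nonneg, fun h => h ▸ abs_nonneg a⟩

theorem eq_zero_of_abs_eq_zero {a : G} (h : |a| = 0) : a = 0 := by
  refine le_antisymm (h ▸ le_abs_self a) ?_
  have := neg_le_abs a
  rw [h] at this
  simpa using this

theorem abs_sub_le_of_le {a b c : G} (h1 : a ≤ b + c) (h2 : b ≤ a + c) : |a - b| ≤ c :=
  abs_le'.2 ⟨sub_le_iff_le_add'.2 h1, by rw [neg_sub]; exact sub_le_iff_le_add'.2 h2⟩

end LatticeGroup

/-! ### `f`-algebras -/

namespace FAlgebra

variable {A : Type u} [CommRing A] [Algebra ℝ A] [Lattice A] [FAlgebra A]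

/-- Two uses of the `f`-algebra axiom give `(a * b) ⊓ (a * b) = 0`. -/
theorem mul_eq_zero_of_inf_eq_zero {a b : A} (h : a ⊓ b = 0) : a * b = 0 := by
  have ha : 0 ≤ a := h ▸ inf_le_left
  have hb : 0 ≤ b := h ▸ inf_le_right
  have h1 := mul_inf_eq_zero a b b h hb
  have h2 := mul_inf_eq_zero b (a * b) a (by rwa [inf_comm]) ha
  rwa [mul_comm b a, inf_idem] at h2

/-- Expanding both factors into positive and negative parts writes `a * b` as a difference of two
disjoint elements, whose sum is `|a| * |b|`. -/
theorem abs_mul' (a b : A) : |a * b| = |a| * |b| := by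
  have dis : ∀ c : A, c⁺ ⊓ c⁻ = 0 := posPart_inf_negPart_eq_zero
  have dis' : ∀ c : A, c⁻ ⊓ c⁺ = 0 := fun c => by rw [inf_comm, dis]
  have key : ∀ x y z t : A, x ⊓ y = 0 → 0 ≤ z → 0 ≤ t → (x * z) ⊓ (y * t) = 0 := by
    intro x y z t h hz ht
    have h1 := mul_inf_eq_zero x y z h hz
    rw [inf_comm] at h1
    rw [inf_comm]
    exact mul_inf_eq_zero _ _ t h1 ht
  have h : (a⁺ * b⁺ + a⁻ * b⁻) ⊓ (a⁺ * b⁻ + a⁻ * b⁺) = 0 := by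
    have e1 : (a⁺ * b⁺) ⊓ (a⁺ * b⁻) = 0 := by
      rw [mul_comm a⁺ b⁺, mul_comm a⁺ b⁻]
      exact key _ _ _ _ (dis b) (posPart_nonneg a) (posPart_nonneg a)
    have e2 : (a⁺ * b⁺) ⊓ (a⁻ * b⁺) = 0 :=
      key _ _ _ _ (dis a) (posPart_nonneg b) (posPart_nonneg b)
    have e3 : (a⁻ * b⁻) ⊓ (a⁺ * b⁻) = 0 :=
      key _ _ _ _ (dis' a) (negPart_nonneg b) (negPart_nonneg b)
    have e4 : (a⁻ * b⁻) ⊓ (a⁻ * b⁺) = 0 := by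
      rw [mul_comm a⁻ b⁺, mul_comm a⁻ b⁻]
      exact key _ _ _ _ (dis' b) (negPart_nonneg a) (negPart_nonneg a)
    refine add_inf_eq_zero ?_ ?_
    · rw [inf_comm] at e1 e2 ⊢
      exact add_inf_eq_zero e1 e2
    · rw [inf_comm] at e3 e4 ⊢
      exact add_inf_eq_zero e3 e4
  have h2 := abs_sub_eq_add_of_inf_eq_zero h
  rw [← posPart_add_negPart a, ← posPart_add_negPart b]
  have e : a * b = a⁺ * b⁺ + a⁻ * b⁻ - (a⁺ * b⁻ + a⁻ * b⁺) := by
    conv_lhs => rw [← posPart_sub_negPart a, ← posPart_sub_negPart b]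
    ring
  rw [e, h2]
  ring

/-- Since `p⁺ * p⁻ = 0`, the square of `p` is the sum of the squares of `p⁺` and `p⁻`. -/
theorem idem_nonneg {p : A} (hp : p * p = p) : 0 ≤ p := by
  have e1 : p * p = p⁺ * p⁺ + p⁻ * p⁻ := by
    have := mul_eq_zero_of_inf_eq_zero (posPart_inf_negPart_eq_zero p)
    conv_lhs => rw [← posPart_sub_negPart p]
    linear_combination (-2) * this
  rw [← hp, e1]
  exact add_nonneg (mul_nonneg _ _ (posPart_nonneg p) (posPart_nonneg p))
    (mul_nonneg _ _ (negPart_nonneg p) (negPart_nonneg p))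

theorem one_nonneg : (0 : A) ≤ 1 := idem_nonneg (mul_one 1)

theorem idem_le_one {p : A} (hp : p * p = p) : p ≤ 1 := by
  have : 0 ≤ 1 - p := idem_nonneg (by linear_combination hp)
  exact sub_nonneg.1 this

theorem idem_inf_eq_zero_iff {p q : A} (hp : p * p = p) (hq : q * q = q) :
    |p| ⊓ |q| = 0 ↔ p * q = 0 := by
  rw [abs_of_nonneg (idem_nonneg hp), abs_of_nonneg (idem_nonneg hq)]
  refine ⟨mul_eq_zero_of_inf_eq_zero, fun h => ?_⟩
  have h0 : 0 ≤ p ⊓ q := le_inf (idem_nonneg hp) (idem_nonneg hq)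
  refine le_antisymm ?_ h0
  -- When `p * q = 0`, the two non-negative products `h1` and `h2` add up to `-(p ⊓ q)`.
  have h1 : 0 ≤ (1 - p) * (p - p ⊓ q) := mul_nonneg _ _ (sub_nonneg.2 (idem_le_one hp))
    (sub_nonneg.2 inf_le_left)
  have h2 : 0 ≤ p * (q - p ⊓ q) := mul_nonneg _ _ (idem_nonneg hp) (sub_nonneg.2 inf_le_right)
  have h3 := add_nonneg h1 h2
  have e : (1 - p) * (p - p ⊓ q) + p * (q - p ⊓ q) = - (p ⊓ q) := by
    linear_combination h - hp
  rw [e] at h3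
  simpa using h3

theorem algebraMap_nonneg {c : ℝ} (hc : 0 ≤ c) : 0 ≤ algebraMap ℝ A c := by
  rw [Algebra.algebraMap_eq_smul_one]
  exact smul_nonneg hc one_nonneg

theorem abs_algebraMap (c : ℝ) : |algebraMap ℝ A c| = algebraMap ℝ A |c| := by
  rcases le_total 0 c with h | h
  · rw [abs_of_nonneg h, abs_of_nonneg (algebraMap_nonneg h)]
  · rw [abs_of_nonpos h, ← abs_neg, ← map_neg,
      abs_of_nonneg (algebraMap_nonneg (neg_nonneg.2 h))]

end FAlgebra

/-- An algebraic description of the countable partitions of `1`. -/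
structure IsPartition {A : Type u} [CommRing A] (p : ℕ → A) : Prop where
  idem : ∀ n, p n * p n = p n
  disjoint : ∀ n m, n ≠ m → p n * p m = 0
  eq_zero : ∀ a : A, (∀ n, p n * a = 0) → a = 0

/-! ### Countable partitions of `1` in algebraic form -/

section Partition

variable {A : Type u} [CommRing A] [Algebra ℝ A] [Lattice A]

theorem IsPartition.isCountablePartition [FAlgebra A] {p : ℕ → A} (hp : IsPartition p) :
    IsCountablePartition p 1 where
  idem := hp.idem
  disjoint n m h := (FAlgebra.idem_inf_eq_zero_iff (hp.idem n) (hp.idem m)).2 (hp.disjoint n m h)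
  isLUB := by
    refine ⟨?_, fun w hw => ?_⟩
    · rintro _ ⟨n, rfl⟩
      exact FAlgebra.idem_le_one (hp.idem n)
    · have hw' : ∀ n, 0 ≤ w - p n := fun n => sub_nonneg.2 (hw ⟨n, rfl⟩)
      -- Positivity is turned into an equation, since only equations can be tested on the members of
      -- the partition.
      suffices h : |w - 1| - (w - 1) = 0 by
        rw [← sub_nonneg, nonneg_iff_abs_eq]
        exact sub_eq_zero.1 h
      refine hp.eq_zero _ fun n => ?_
      have h1 : p n * |w - 1| = |p n * (w - 1)| := by
        rw [FAlgebra.abs_mul', abs_of_nonneg (FAlgebra.idem_nonneg (hp.idem n))]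
      have h2 : p n * (w - 1) = p n * (w - p n) := by linear_combination (hp.idem n)
      rw [mul_sub, h1, h2, abs_of_nonneg, sub_self]
      exact FAlgebra.mul_nonneg _ _ (FAlgebra.idem_nonneg (hp.idem n)) (hw' n)

/-- By σ-order-continuity of the multiplication, `|a|` is the supremum of the products of `|a|` with
the partial sums of `p`, all of which vanish if every `p n * a` does. -/
theorem IsCountablePartition.isPartition [LocalisableFAlgebra A] {p : ℕ → A}
    (hp : IsCountablePartition p 1) : IsPartition p where
  idem := hp.idem
  disjoint n m h := (FAlgebra.idem_inf_eq_zero_iff (hp.idem n) (hp.idem m)).1 (hp.disjoint n m h)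
  eq_zero a ha := by
    have idem : ∀ n, p n * p n = p n := hp.idem
    have dis : ∀ n m, n ≠ m → p n * p m = 0 := fun n m h =>
      (FAlgebra.idem_inf_eq_zero_iff (hp.idem n) (hp.idem m)).1 (hp.disjoint n m h)
    have h0 : ∀ n, 0 ≤ p n := fun n => FAlgebra.idem_nonneg (idem n)
    have hz : ∀ n, p n * ∑ i ∈ Finset.range n, p i = 0 := fun n => by
      rw [Finset.mul_sum]
      exact Finset.sum_eq_zero fun i hi => dis _ _ (Finset.mem_range.1 hi).ne'
    have hidem : ∀ n, (∑ i ∈ Finset.range n, p i) * (∑ i ∈ Finset.range n, p i) =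
        ∑ i ∈ Finset.range n, p i := by
      intro n
      induction n with
      | zero => simp
      | succ n ih =>
        rw [Finset.sum_range_succ]
        linear_combination ih + idem n + 2 * hz n
    let P : ℕ → {a : A // 0 ≤ a} × {a : A // 0 ≤ a} := fun n =>
      (⟨∑ i ∈ Finset.range n, p i, FAlgebra.idem_nonneg (hidem n)⟩, ⟨|a|, abs_nonneg a⟩)
    have hmono : Monotone P := by
      refine monotone_nat_of_le_succ fun n => ⟨?_, le_rfl⟩
      show ∑ i ∈ Finset.range n, p i ≤ ∑ i ∈ Finset.range (n + 1), p i
      rw [Finset.sum_range_succ]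
      exact le_add_of_nonneg_right (h0 n)
    have hlub : IsLUB (Set.range P) (⟨1, FAlgebra.one_nonneg⟩, ⟨|a|, abs_nonneg a⟩) := by
      refine ⟨?_, fun w hw => ⟨?_, (hw ⟨0, rfl⟩).2⟩⟩
      · rintro _ ⟨n, rfl⟩
        exact ⟨FAlgebra.idem_le_one (hidem n), le_rfl⟩
      · refine hp.isLUB.2 ?_
        rintro _ ⟨n, rfl⟩
        have h1 : ∑ i ∈ Finset.range (n + 1), p i ≤ (w.1 : A) := (hw ⟨n + 1, rfl⟩).1
        rw [Finset.sum_range_succ] at h1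
        exact (le_add_of_nonneg_left (FAlgebra.idem_nonneg (hidem n))).trans h1
    have h := (LocalisableFAlgebra.mul_sigmaOrderContinuous (A := A)).sup P _ hmono hlub
    have h1 : ∀ n, p n * |a| = 0 := fun n => by
      rw [← abs_of_nonneg (h0 n), ← FAlgebra.abs_mul', ha n, abs_zero]
    have h2 : (1 : A) * |a| ≤ 0 := by
      refine h.2 ?_
      rintro _ ⟨n, rfl⟩
      show (∑ i ∈ Finset.range n, p i) * |a| ≤ 0
      rw [Finset.sum_mul, Finset.sum_eq_zero fun i _ => h1 i]
    rw [one_mul] at h2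
    exact eq_zero_of_abs_eq_zero (le_antisymm h2 (abs_nonneg a))

/-- The common refinement of a partition and a sequence of partitions. -/
theorem IsPartition.refine {A : Type u} [CommRing A] {p : ℕ → A} (hp : IsPartition p)
    {q : ℕ → ℕ → A} (hq : ∀ n, IsPartition (q n)) :
    IsPartition fun k : ℕ => p k.unpair.1 * q k.unpair.1 k.unpair.2 where
  idem k := by
    linear_combination (q k.unpair.1 k.unpair.2 * q k.unpair.1 k.unpair.2) * hp.idem k.unpair.1 +
      p k.unpair.1 * (hq k.unpair.1).idem k.unpair.2
  disjoint k l h := by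
    by_cases h1 : k.unpair.1 = l.unpair.1
    · have h2 : k.unpair.2 ≠ l.unpair.2 := fun h2 => h (by
        rw [← Nat.pair_unpair k, ← Nat.pair_unpair l, h1, h2])
      rw [h1]
      linear_combination (p l.unpair.1 * p l.unpair.1) * (hq l.unpair.1).disjoint _ _ h2
    · linear_combination (q k.unpair.1 k.unpair.2 * q l.unpair.1 l.unpair.2) *
        hp.disjoint _ _ h1
  eq_zero a ha := hp.eq_zero a fun n => (hq n).eq_zero _ fun m => by
    have := ha (Nat.pair n m)
    simp only [Nat.unpair_pair] at this
    linear_combination this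

theorem IsFinitePartition.isPartition [FAlgebra A] {n : ℕ} {p : Fin n → A}
    (hp : IsFinitePartition p 1) :
    IsPartition fun k : ℕ => if h : k < n then p ⟨k, h⟩ else 0 where
  idem k := by
    split_ifs with h
    · exact hp.idem _
    · simp
  disjoint k l hkl := by
    split_ifs with h1 h2
    · exact (FAlgebra.idem_inf_eq_zero_iff (hp.idem _) (hp.idem _)).1
        (hp.disjoint _ _ (by simpa using hkl))
    all_goals simp
  eq_zero a ha := by
    rw [← one_mul a, ← hp.sum_eq, Finset.sum_mul]
    refine Finset.sum_eq_zero fun i _ => ?_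
    have := ha i
    simpa using this

/-- Locally on a partition, a simple element is a real number. -/
theorem exists_isPartition_of_mem_simpleElements [FAlgebra A] {a : A}
    (ha : a ∈ simpleElements A) :
    ∃ (p : ℕ → A) (c : ℕ → ℝ), IsPartition p ∧ ∀ n, p n * a = p n * algebraMap ℝ A (c n) := by
  obtain ⟨n, c, p, hp, rfl⟩ := ha
  refine ⟨_, fun k => if h : k < n then c ⟨k, h⟩ else 0, hp.isPartition, fun k => ?_⟩
  by_cases h : k < n
  · simp only [h, dite_true]
    rw [Finset.mul_sum, Finset.sum_eq_single ⟨k, h⟩, mul_smul_comm, hp.idem, mul_comm,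
      ← Algebra.smul_def]
    · intro j _ hj
      rw [mul_smul_comm, (FAlgebra.idem_inf_eq_zero_iff (hp.idem _) (hp.idem _)).1
        (hp.disjoint _ _ hj.symm), smul_zero]
    · simp
  · simp [h]

end Partition

/-! ### Metric Riesz spaces -/

namespace MetricRieszSpace

variable {V : Type u} [AddCommGroup V] [Module ℝ V] [Lattice V] [MetricSpace V]
  [MetricRieszSpace V]

/-- The group norm `v ↦ d(v, 0)` of a metric Riesz space. -/
@[reducible]
def normedAddCommGroup (V : Type u) [AddCommGroup V] [Module ℝ V] [Lattice V] [MetricSpace V]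
    [MetricRieszSpace V] : NormedAddCommGroup V where
  norm v := dist v 0
  dist_eq a b := by
    have := dist_translation a b (-a)
    rw [add_neg_cancel] at this
    rw [this, dist_comm, add_comm]

theorem dist_eq_dist_sub (a b : V) : dist a b = dist (a - b) 0 := by
  have := dist_translation a b (-b)
  rwa [add_neg_cancel, ← sub_eq_add_neg] at this

instance : IsUniformAddGroup V := by
  let _ := normedAddCommGroup V
  infer_instance

theorem dist_add_zero_le (a b : V) : dist (a + b) 0 ≤ dist a 0 + dist b 0 := by
  let _ := normedAddCommGroup V
  exact norm_add_le a b

theorem dist_zero_le_of_abs_le {a b : V} (h : |a| ≤ b) : dist a 0 ≤ dist b 0 := by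
  rw [dist_abs a]
  exact dist_mono _ _ (abs_nonneg a) h

theorem dist_abs_sub_abs_le (a b : V) : dist |a| |b| ≤ dist a b := by
  rw [dist_eq_dist_sub, dist_eq_dist_sub a b, dist_abs (a - b)]
  exact dist_zero_le_of_abs_le (abs_abs_sub_abs_le a b)

theorem continuous_abs' : Continuous fun a : V => |a| :=
  (LipschitzWith.of_dist_le_mul (K := 1) fun a b => by
    simpa using dist_abs_sub_abs_le a b).continuous

/-- The order is the closed condition `|b - a| = b - a`, because the absolute value is 1-Lipschitz.
-/
instance : OrderClosedTopology V where
  isClosed_le' := by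
    have : {p : V × V | p.1 ≤ p.2} = {p : V × V | |p.2 - p.1| = p.2 - p.1} := by
      ext p
      rw [Set.mem_ofPred_eq, Set.mem_ofPred_eq, ← nonneg_iff_abs_eq, sub_nonneg]
    rw [this]
    exact isClosed_eq (continuous_abs'.comp (continuous_snd.sub continuous_fst))
      (continuous_snd.sub continuous_fst)

end MetricRieszSpace

open MetricRieszSpace

/-! ### Metric modules over metric `f`-algebras -/

/-- The abstract properties of the `U`-module `V` in a metric `f`-structure. -/
class MetricFModule (U : Type u) (V : Type v) [CommRing U] [Algebra ℝ U] [Lattice U]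
    [MetricSpace U] [MetricFAlgebra U] [AddCommGroup V] [Module ℝ V] [Lattice V] [MetricSpace V]
    [MetricRieszSpace V] [Module U V] : Prop where
  algebraMap_smul : ∀ (c : ℝ) (b : V), algebraMap ℝ U c • b = c • b
  abs_smul : ∀ (a : U) (b : V), |a • b| = |a| • |b|
  continuous_smul : Continuous fun p : U × V => p.1 • p.2
  eq_zero : ∀ p : ℕ → U, IsPartition p → ∀ b : V, (∀ n, p n • b = 0) → b = 0
  exists_delta : ∀ p : ℕ → U, IsPartition p → ∀ ε : ℝ, 0 < ε → ∃ δ : ℝ, 0 < δ ∧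
    ∀ x : ℕ → V, (∀ n, 0 ≤ x n) → Summable (fun n => dist (p n • x n) 0) →
      ∑' n, dist (p n • x n) 0 ≤ δ →
        ∃ s : V, IsLUB (Set.range fun n => p n • x n) s ∧ dist s 0 ≤ ε

namespace MetricFModule

variable {U : Type u} {V : Type v} [CommRing U] [Algebra ℝ U] [Lattice U]
    [MetricSpace U] [MetricFAlgebra U] [AddCommGroup V] [Module ℝ V] [Lattice V] [MetricSpace V]
    [MetricRieszSpace V] [Module U V] [MetricFModule U V]

theorem smul_nonneg' {a : U} {b : V} (ha : 0 ≤ a) (hb : 0 ≤ b) : 0 ≤ a • b := by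
  rw [nonneg_iff_abs_eq, abs_smul, abs_of_nonneg ha, abs_of_nonneg hb]

theorem smul_le_smul_left' {a : U} {b c : V} (ha : 0 ≤ a) (h : b ≤ c) : a • b ≤ a • c := by
  rw [← sub_nonneg, ← smul_sub]
  exact smul_nonneg' ha (sub_nonneg.2 h)

theorem smul_le_smul_right' {a b : U} {c : V} (h : a ≤ b) (hc : 0 ≤ c) : a • c ≤ b • c := by
  rw [← sub_nonneg, ← sub_smul]
  exact smul_nonneg' (sub_nonneg.2 h) hc

theorem idem_smul_le {p : U} (hp : p * p = p) {b : V} (hb : 0 ≤ b) : p • b ≤ b := by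
  simpa using smul_le_smul_right' (FAlgebra.idem_le_one hp) hb

theorem le_of_partition {p : ℕ → U} (hp : IsPartition p) {b c : V}
    (h : ∀ n, p n • b ≤ p n • c) : b ≤ c := by
  rw [← sub_nonneg, nonneg_iff_abs_eq, ← sub_eq_zero]
  refine eq_zero p hp _ fun n => ?_
  have h1 := abs_smul (p n) (c - b)
  rw [abs_of_nonneg (FAlgebra.idem_nonneg (hp.idem n)), abs_of_nonneg] at h1
  · rw [smul_sub, ← h1, sub_self]
  · rw [smul_sub]
    exact sub_nonneg.2 (h n)

theorem eq_of_partition {p : ℕ → U} (hp : IsPartition p) {b c : V}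
    (h : ∀ n, p n • b = p n • c) : b = c :=
  le_antisymm (le_of_partition hp fun n => (h n).le) (le_of_partition hp fun n => (h n).ge)

theorem isGLB_idem_smul {p : U} (hp : p * p = p) {ι : Type*} [Nonempty ι] {f : ι → V} {b : V}
    (h : IsGLB (Set.range f) b) : IsGLB (Set.range fun i => p • f i) (p • b) := by
  have h0 := FAlgebra.idem_nonneg hp
  have h0' : 0 ≤ 1 - p := sub_nonneg.2 (FAlgebra.idem_le_one hp)
  have hpp : (1 - p) * p = 0 := by linear_combination -hp
  have split : ∀ c : V, p • c + (1 - p) • c = c := fun c => by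
    rw [← add_smul, add_sub_cancel, one_smul]
  refine ⟨?_, fun c hc => ?_⟩
  · rintro _ ⟨i, rfl⟩
    exact smul_le_smul_left' h0 (h.1 ⟨i, rfl⟩)
  -- Off `p`, the lower bound `c` is replaced by `b`; the result is a lower bound of `f` itself.
  have h1 : p • c + (1 - p) • b ≤ b := by
    refine h.2 ?_
    rintro _ ⟨i, rfl⟩
    rw [← split (f i)]
    refine add_le_add ?_ (smul_le_smul_left' h0' (h.1 ⟨i, rfl⟩))
    have := smul_le_smul_left' h0 (hc ⟨i, rfl⟩)
    rwa [smul_smul p p, hp] at this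
  have h2 : p • c ≤ p • b := by
    have := smul_le_smul_left' h0 h1
    rwa [smul_add, smul_smul, smul_smul, hp, mul_comm, hpp, zero_smul, add_zero] at this
  obtain ⟨i⟩ := ‹Nonempty ι›
  have h3 : (1 - p) • c ≤ 0 := by
    have := smul_le_smul_left' h0' (hc ⟨i, rfl⟩)
    rwa [smul_smul, hpp, zero_smul] at this
  rw [← split c]
  exact (add_le_add h2 h3).trans (add_zero _).le

theorem isLUB_idem_smul {p : U} (hp : p * p = p) {ι : Type*} [Nonempty ι] {f : ι → V} {b : V}
    (h : IsLUB (Set.range f) b) : IsLUB (Set.range fun i => p • f i) (p • b) := by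
  have key : ∀ (g : ι → V) (c : V), IsLUB (Set.range g) c ↔
      IsGLB (Set.range fun i => - g i) (-c) := by
    intro g c
    have e : (Set.range fun i => - g i) = -(Set.range g) := by
      ext x
      simp only [Set.mem_neg, Set.mem_range]
      exact exists_congr fun i => neg_eq_iff_eq_neg
    rw [e, isGLB_neg, neg_neg]
  rw [key] at h ⊢
  simpa using isGLB_idem_smul hp h

theorem tendsto_smul_zero (U : Type u) {V : Type v} [CommRing U] [Algebra ℝ U] [Lattice U]
    [MetricSpace U] [MetricFAlgebra U] [AddCommGroup V] [Module ℝ V] [Lattice V] [MetricSpace V]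
    [MetricRieszSpace V] [Module U V] [MetricFModule U V]
    (b : V) : Filter.Tendsto (fun n : ℕ => (1 / ((n : ℝ) + 1)) • b)
    Filter.atTop (nhds 0) := by
  have h1 : Filter.Tendsto (fun n : ℕ => 1 / ((n : ℝ) + 1)) Filter.atTop
      (nhdsWithin 0 (Set.Ioi 0)) :=
    tendsto_nhdsWithin_iff.2 ⟨tendsto_one_div_add_atTop_nhds_zero_nat,
      Filter.Eventually.of_forall fun n => Set.mem_Ioi.2 (by positivity)⟩
  have h2 : Filter.Tendsto (fun n : ℕ => (1 / ((n : ℝ) + 1)) • (1 : U)) Filter.atTop (nhds 0) :=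
    tendsto_iff_dist_tendsto_zero.2 (MetricFAlgebra.tendsto_smul_one.comp h1)
  have h3 := ((continuous_smul (U := U) (V := V)).tendsto (0, b)).comp
    (h2.prodMk_nhds (tendsto_const_nhds (x := b)))
  simp only [zero_smul] at h3
  refine h3.congr fun n => ?_
  simp only [Function.comp]
  rw [← Algebra.algebraMap_eq_smul_one, algebraMap_smul]

/-- An Archimedean property in metric form: it rests on the axiom that `ε • 1` tends to `0` in `U`.
-/
theorem le_of_forall_le_add_smul (U : Type u) {V : Type v} [CommRing U] [Algebra ℝ U] [Lattice U]
    [MetricSpace U] [MetricFAlgebra U] [AddCommGroup V] [Module ℝ V] [Lattice V] [MetricSpace V]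
    [MetricRieszSpace V] [Module U V] [MetricFModule U V]
    {a b c : V}
    (h : ∀ ε : ℝ, 0 < ε → a ≤ b + ε • c) : a ≤ b := by
  have := (tendsto_smul_zero U c).const_add b
  rw [add_zero] at this
  exact ge_of_tendsto' this fun n => h _ (by positivity)

end MetricFModule

/-! ### The module of a metric `f`-structure -/

namespace MetricFStructure

variable {𝒰 : Type u} [CommRing 𝒰] [Algebra ℝ 𝒰] [Lattice 𝒰] [LocalisableFAlgebra 𝒰]
  (S : MetricFStructure 𝒰)

theorem mul_mem (a : S.U) (b : S.V) : (a : 𝒰) * (b : 𝒰) ∈ S.V.toSubmodule :=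
  S.image_mul.subset (Set.mem_image2_of_mem a.2 b.2)

instance instModule : Module S.U S.V where
  smul a b := ⟨(a : 𝒰) * (b : 𝒰), S.mul_mem a b⟩
  one_smul b := Subtype.ext (one_mul (b : 𝒰))
  mul_smul a b c := Subtype.ext (mul_assoc (a : 𝒰) b c)
  smul_zero a := Subtype.ext (mul_zero (a : 𝒰))
  smul_add a b c := Subtype.ext (mul_add (a : 𝒰) b c)
  add_smul a b c := Subtype.ext (add_mul (a : 𝒰) b c)
  zero_smul b := Subtype.ext (zero_mul (b : 𝒰))

theorem isPartition_coe {p : ℕ → S.U} (hp : IsPartition p) :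
    IsPartition fun n => (p n : 𝒰) := by
  refine IsCountablePartition.isPartition ?_
  have hidem : ∀ n, (p n : 𝒰) * (p n : 𝒰) = p n := fun n => congrArg Subtype.val (hp.idem n)
  refine ⟨hidem, fun n m h => ?_, ?_, fun w hw => ?_⟩
  · rw [FAlgebra.idem_inf_eq_zero_iff (hidem n) (hidem m)]
    exact congrArg Subtype.val (hp.disjoint n m h)
  · rintro _ ⟨n, rfl⟩
    exact FAlgebra.idem_le_one (hidem n)
  -- An upper bound `w` in `𝒰` need not lie in `U`, but `w ⊓ 1` does, by solidity.
  · have h0 : 0 ≤ w ⊓ 1 := le_inf ((FAlgebra.idem_nonneg (hidem 0)).trans (hw ⟨0, rfl⟩))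
      FAlgebra.one_nonneg
    have hm : w ⊓ 1 ∈ S.U.toSubalgebra := by
      refine S.U.solid' _ 1 (one_mem _) ?_
      rw [abs_of_nonneg h0, abs_of_nonneg FAlgebra.one_nonneg]
      exact inf_le_right
    have h1 : (1 : S.U) ≤ ⟨w ⊓ 1, hm⟩ := hp.isCountablePartition.isLUB.2 (by
      rintro _ ⟨n, rfl⟩
      exact le_inf (hw ⟨n, rfl⟩) (FAlgebra.idem_le_one (hidem n)))
    exact (show (1 : 𝒰) ≤ w ⊓ 1 from h1).trans inf_le_left

instance instMetricFModule : MetricFModule S.U S.V where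
  algebraMap_smul c b := Subtype.ext (Algebra.smul_def c (b : 𝒰)).symm
  abs_smul a b := Subtype.ext (FAlgebra.abs_mul' (a : 𝒰) b)
  continuous_smul := S.continuous_mul
  eq_zero p hp b hb := Subtype.ext ((S.isPartition_coe hp).eq_zero _ fun n =>
    congrArg Subtype.val (hb n))
  exists_delta p hp ε hε := by
    obtain ⟨δ, hδ, h⟩ := S.exists_delta p hp.isCountablePartition ε hε
    exact ⟨δ, hδ, fun x hx hs ht => (h x _ hx (fun n => rfl) hs ht).2⟩

end MetricFStructure

/-! ### Pointwise norms and glueing -/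

/-- A `V`-valued pointwise norm on the `U`-module `E`, without the glueing property. -/
structure PointwiseNorm (U : Type*) (V : Type*) (E : Type*) [CommRing U] [Lattice U]
    [AddCommGroup V] [Lattice V] [Module U V] [AddCommGroup E] [Module U E] where
  toFun : E → V
  nonneg : ∀ x, 0 ≤ toFun x
  eq_zero_iff : ∀ x, toFun x = 0 ↔ x = 0
  add_le : ∀ x y, toFun (x + y) ≤ toFun x + toFun y
  smul_eq : ∀ (a : U) (x : E), toFun (a • x) = |a| • toFun x

section

variable {U : Type*} {V : Type*} [CommRing U] [Algebra ℝ U] [Lattice U]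
  [MetricSpace U] [MetricFAlgebra U] [AddCommGroup V] [Module ℝ V] [Lattice V] [MetricSpace V]
  [MetricRieszSpace V] [Module U V] [MetricFModule U V]
  {E : Type*} [AddCommGroup E] [Module U E] {F : Type*} [AddCommGroup F] [Module U F]
  {𝒱 : Type*} [AddCommGroup 𝒱] [Module ℝ 𝒱]

theorem le_of_forall_exists_le_add {a b : V}
    (h : ∀ ε : ℝ, 0 < ε → ∃ e : V, dist e 0 < ε ∧ a ≤ b + e) : a ≤ b := by
  choose e he h using fun n : ℕ => h (1 / ((n : ℝ) + 1)) (by positivity)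
  have h1 : Filter.Tendsto e Filter.atTop (nhds 0) :=
    tendsto_iff_dist_tendsto_zero.2 (squeeze_zero (fun _ => dist_nonneg) (fun n => (he n).le)
      tendsto_one_div_add_atTop_nhds_zero_nat)
  have h2 := h1.const_add b
  rw [add_zero] at h2
  exact ge_of_tendsto' h2 h

theorem exists_dist_smul_lt (a : U) {ε : ℝ} (hε : 0 < ε) :
    ∃ δ : ℝ, 0 < δ ∧ ∀ b : V, dist b 0 < δ → dist (a • b) 0 < ε := by
  have hc : Continuous fun b : V => a • b :=
    (MetricFModule.continuous_smul (U := U) (V := V)).comp (continuous_const.prodMk continuous_id)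
  obtain ⟨δ, hδ, h⟩ := Metric.continuous_iff.1 hc 0 ε hε
  simp only [smul_zero] at h
  exact ⟨δ, hδ, h⟩

theorem exists_simple_dist_smul_lt (a : U) (b : V) {ε : ℝ} (hε : 0 < ε) :
    ∃ s ∈ simpleElements U, dist ((a - s) • b) 0 < ε := by
  have hc : Continuous fun s : U => (a - s) • b :=
    (MetricFModule.continuous_smul (U := U) (V := V)).comp
      ((continuous_const.sub continuous_id).prodMk continuous_const)
  have ho : IsOpen {s : U | dist ((a - s) • b) 0 < ε} :=
    isOpen_lt (hc.dist continuous_const) continuous_const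
  obtain ⟨s, hs, hs'⟩ := (MetricFAlgebra.dense_simple (A := U)).exists_mem_open ho
    ⟨a, by simpa using hε⟩
  exact ⟨s, hs, hs'⟩

/-- The elements of `E` that on each member of some partition of `1` coincide with an element of
the range of `T`. -/
def gluedSet (T : 𝒱 →ₛₗ[algebraMap ℝ U] E) : Set E :=
  {y | ∃ (p : ℕ → U) (x : ℕ → 𝒱), IsPartition p ∧ ∀ n, p n • y = p n • T (x n)}

namespace PointwiseNorm

variable (N : PointwiseNorm U V E)

theorem map_zero : N.toFun 0 = 0 := (N.eq_zero_iff 0).2 rfl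

theorem map_neg (x : E) : N.toFun (-x) = N.toFun x := by
  have := N.smul_eq (-1) x
  rwa [neg_one_smul, abs_neg, abs_of_nonneg FAlgebra.one_nonneg, one_smul] at this

theorem map_sub_rev (x y : E) : N.toFun (x - y) = N.toFun (y - x) := by
  rw [← N.map_neg, neg_sub]

theorem sub_le (x y z : E) : N.toFun (x - z) ≤ N.toFun (x - y) + N.toFun (y - z) := by
  simpa using N.add_le (x - y) (y - z)

theorem le_add_sub (x y : E) : N.toFun x ≤ N.toFun y + N.toFun (x - y) := by
  simpa using N.add_le y (x - y)

theorem idem_smul {p : U} (hp : p * p = p) (x : E) : N.toFun (p • x) = p • N.toFun x := by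
  rw [N.smul_eq, abs_of_nonneg (FAlgebra.idem_nonneg hp)]

theorem dist_sub_le (x y z : E) : dist (N.toFun (x - z)) 0 ≤
    dist (N.toFun (x - y)) 0 + dist (N.toFun (y - z)) 0 :=
  (dist_mono _ _ (N.nonneg _) (N.sub_le x y z)).trans (dist_add_zero_le _ _)

theorem eq_of_partition (N : PointwiseNorm U V E) {p : ℕ → U} (hp : IsPartition p) {x y : E}
    (h : ∀ n, p n • x = p n • y) : x = y := by
  rw [← sub_eq_zero, ← N.eq_zero_iff]
  refine MetricFModule.eq_zero p hp _ fun n => ?_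
  rw [← N.idem_smul (hp.idem n), smul_sub, h, sub_self, N.map_zero]

theorem eq_of_forall_dist_lt {x y : E} (h : ∀ ε : ℝ, 0 < ε → dist (N.toFun (x - y)) 0 < ε) :
    x = y := by
  rw [← sub_eq_zero, ← N.eq_zero_iff]
  exact eq_of_forall_dist_le fun ε hε => (h ε hε).le

/-- The closure of a set for the distance `d(x, y) = d_V(|x - y|, 0)`. -/
def closure (A : Set E) : Set E :=
  {y | ∀ ε : ℝ, 0 < ε → ∃ a ∈ A, dist (N.toFun (y - a)) 0 < ε}

theorem subset_closure (A : Set E) : A ⊆ N.closure A := fun y hy ε hε =>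
  ⟨y, hy, by rwa [sub_self, N.map_zero, dist_self]⟩

theorem closure_closure_subset (A : Set E) : N.closure (N.closure A) ⊆ N.closure A := by
  intro y hy ε hε
  obtain ⟨a, ha, h1⟩ := hy (ε / 2) (by linarith)
  obtain ⟨b, hb, h2⟩ := ha (ε / 2) (by linarith)
  exact ⟨b, hb, by linarith [N.dist_sub_le y a b]⟩

/-- Completeness for the distance `d(x, y) = d_V(|x - y|, 0)`, for rapidly converging sequences. -/
def IsComplete : Prop :=
  ∀ x : ℕ → E, (∀ m n, dist (N.toFun (x m - x n)) 0 ≤ (1 / 2) ^ m + (1 / 2) ^ n) →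
    ∃ y, ∀ n, dist (N.toFun (x n - y)) 0 ≤ (1 / 2) ^ n

/-- The glueing property. -/
def HasGlueing : Prop :=
  ∀ p : ℕ → U, IsPartition p → ∀ (x : ℕ → E) (b : V), (∀ n, p n • N.toFun (x n) ≤ b) →
    ∃ y : E, ∀ n, p n • y = p n • x n

/-- The sum norm on the product. -/
@[simps]
def prod (N : PointwiseNorm U V E) (N' : PointwiseNorm U V F) : PointwiseNorm U V (E × F) where
  toFun x := N.toFun x.1 + N'.toFun x.2
  nonneg x := add_nonneg (N.nonneg _) (N'.nonneg _)
  eq_zero_iff x := by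
    rw [add_eq_zero_iff_of_nonneg (N.nonneg _) (N'.nonneg _), N.eq_zero_iff, N'.eq_zero_iff,
      Prod.ext_iff]
    rfl
  add_le x y := by
    rw [add_add_add_comm]
    exact add_le_add (N.add_le _ _) (N'.add_le _ _)
  smul_eq a x := by
    rw [smul_add, ← N.smul_eq, ← N'.smul_eq]
    rfl

end PointwiseNorm

/-! ### The glued set and its closure -/

section Glued

variable (T : 𝒱 →ₛₗ[algebraMap ℝ U] E)

theorem mem_gluedSet_of_partition {T : 𝒱 →ₛₗ[algebraMap ℝ U] E} {p : ℕ → U} (hp : IsPartition p)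
    {y : E} {z : ℕ → E} (hz : ∀ n, z n ∈ gluedSet T) (h : ∀ n, p n • y = p n • z n) :
    y ∈ gluedSet T := by
  choose q x hq hx using hz
  refine ⟨_, fun k => x k.unpair.1 k.unpair.2, hp.refine hq, fun k => ?_⟩
  rw [mul_comm, mul_smul, h, smul_comm, hx, ← mul_smul, mul_comm, mul_smul, smul_comm]

theorem map_mem_gluedSet (x : 𝒱) : T x ∈ gluedSet T := by
  obtain ⟨p, c, hp, -⟩ := exists_isPartition_of_mem_simpleElements (A := U) (a := 1)
    ⟨1, 1, fun _ => 1, ⟨fun _ => mul_one 1, fun i j h => (h (Subsingleton.elim i j)).elim,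
      by simp⟩, by simp⟩
  exact ⟨p, fun _ => x, hp, fun n => rfl⟩

theorem add_mem_gluedSet {y z : E} (hy : y ∈ gluedSet T) (hz : z ∈ gluedSet T) :
    y + z ∈ gluedSet T := by
  obtain ⟨p, x, hp, hx⟩ := hy
  obtain ⟨q, x', hq, hx'⟩ := hz
  refine mem_gluedSet_of_partition hp (z := fun n => T (x n) + z)
    (fun n => ⟨q, fun m => x n + x' m, hq, fun m => ?_⟩) (fun n => ?_)
  · rw [map_add, smul_add, smul_add, hx']
  · rw [smul_add, smul_add, hx]

/-- Locally a simple element is a real number, which `T` absorbs. For other scalars this is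
unavailable, so the `U`-submodule is formed only after taking the closure. -/
theorem simple_smul_mem_gluedSet {a : U} (ha : a ∈ simpleElements U) {y : E}
    (hy : y ∈ gluedSet T) : a • y ∈ gluedSet T := by
  obtain ⟨p, c, hp, hc⟩ := exists_isPartition_of_mem_simpleElements ha
  obtain ⟨q, x, hq, hx⟩ := hy
  refine mem_gluedSet_of_partition hp (z := fun n => algebraMap ℝ U (c n) • y)
    (fun n => ⟨q, fun m => c n • x m, hq, fun m => ?_⟩) (fun n => ?_)
  · rw [map_smulₛₗ, smul_comm, hx, smul_comm]
  · rw [smul_smul, hc, mul_smul]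

theorem sub_mem_gluedSet {y z : E} (hy : y ∈ gluedSet T) (hz : z ∈ gluedSet T) :
    y - z ∈ gluedSet T := by
  obtain ⟨q, x, hq, hx⟩ := hz
  rw [sub_eq_add_neg]
  exact add_mem_gluedSet T hy ⟨q, fun n => -x n, hq, fun n => by
    rw [smul_neg, hx, map_neg, smul_neg]⟩

/-- The closure of `gluedSet T`, a submodule over `U`. -/
def gluedClosure (N : PointwiseNorm U V E) : Submodule U E where
  carrier := N.closure (gluedSet T)
  zero_mem' := N.subset_closure _ (by simpa using map_mem_gluedSet T 0)
  add_mem' {y z} hy hz ε hε := by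
    obtain ⟨a, ha, h1⟩ := hy (ε / 2) (by linarith)
    obtain ⟨b, hb, h2⟩ := hz (ε / 2) (by linarith)
    refine ⟨a + b, add_mem_gluedSet T ha hb, ?_⟩
    have h3 := dist_mono _ _ (N.nonneg _) (N.add_le (y - a) (z - b))
    rw [sub_add_sub_comm] at h3
    linarith [dist_add_zero_le (N.toFun (y - a)) (N.toFun (z - b))]
  smul_mem' a y hy ε hε := by
    obtain ⟨δ, hδ, h1⟩ := exists_dist_smul_lt (V := V) |a| (half_pos hε)
    obtain ⟨g, hg, h2⟩ := hy δ hδ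
    -- The element `g` is fixed before `s`, so the simple approximation of `a` is tested against one
    -- vector only.
    obtain ⟨s, hs, h3⟩ := exists_simple_dist_smul_lt a (N.toFun g) (half_pos hε)
    refine ⟨s • g, simple_smul_mem_gluedSet T hs hg, ?_⟩
    have h4 := N.dist_sub_le (a • y) (a • g) (s • g)
    rw [← smul_sub, ← sub_smul, N.smul_eq, N.smul_eq] at h4
    have h5 := h1 _ h2
    rw [dist_abs, MetricFModule.abs_smul, abs_of_nonneg (N.nonneg g)] at h3
    linarith

theorem map_mem_gluedClosure (N : PointwiseNorm U V E) (x : 𝒱) : T x ∈ gluedClosure T N :=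
  N.subset_closure _ (map_mem_gluedSet T x)

end Glued

/-! ### The universal property, by closing the graph -/

section Extension

variable {N : PointwiseNorm U V E} {N' : PointwiseNorm U V F}
  {T : 𝒱 →ₛₗ[algebraMap ℝ U] E} {T' : 𝒱 →ₛₗ[algebraMap ℝ U] F}

/-- The map `x ↦ (T x, T' x)`. -/
@[simps]
def prodMap (T : 𝒱 →ₛₗ[algebraMap ℝ U] E) (T' : 𝒱 →ₛₗ[algebraMap ℝ U] F) :
    𝒱 →ₛₗ[algebraMap ℝ U] E × F where
  toFun x := (T x, T' x)
  map_add' x y := by simp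
  map_smul' c x := by simp

theorem norm_snd_le_of_mem_gluedSet (h : ∀ x, N'.toFun (T' x) ≤ N.toFun (T x)) {y : E} {z : F}
    (hyz : (y, z) ∈ gluedSet (prodMap T T')) : N'.toFun z ≤ N.toFun y := by
  obtain ⟨p, x, hp, hx⟩ := hyz
  refine MetricFModule.le_of_partition hp fun n => ?_
  have h1 : p n • y = p n • T (x n) := congrArg Prod.fst (hx n)
  have h2 : p n • z = p n • T' (x n) := congrArg Prod.snd (hx n)
  rw [← N.idem_smul (hp.idem n), ← N'.idem_smul (hp.idem n), h1, h2, N.idem_smul (hp.idem n),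
    N'.idem_smul (hp.idem n)]
  exact MetricFModule.smul_le_smul_left' (FAlgebra.idem_nonneg (hp.idem n)) (h _)

theorem norm_snd_le_of_mem_gluedClosure (h : ∀ x, N'.toFun (T' x) ≤ N.toFun (T x)) {y : E} {z : F}
    (hyz : (y, z) ∈ gluedClosure (prodMap T T') (N.prod N')) : N'.toFun z ≤ N.toFun y := by
  refine le_of_forall_exists_le_add fun ε hε => ?_
  obtain ⟨⟨y', z'⟩, hm, hd⟩ := hyz ε hε
  refine ⟨_, hd, ?_⟩
  have h1 := norm_snd_le_of_mem_gluedSet h hm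
  have h2 := N'.le_add_sub z z'
  have h3 := N.le_add_sub y' y
  rw [N.map_sub_rev] at h3
  show _ ≤ N.toFun y + (N.toFun (y - y') + N'.toFun (z - z'))
  calc _ ≤ _ := h2
    _ ≤ (N.toFun y + N.toFun (y - y')) + N'.toFun (z - z') := by
      gcongr
      exact h1.trans h3
    _ = _ := add_assoc _ _ _

/-- Glued approximations of `y` lift to glued pairs; the second components inherit the Cauchy
estimate from the first because norms do not increase along glued pairs. -/
theorem exists_mem_gluedClosure (h : ∀ x, N'.toFun (T' x) ≤ N.toFun (T x))
    (hc : N'.IsComplete) (hg : N'.HasGlueing) {y : E} (hy : y ∈ gluedClosure T N) :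
    ∃ z, (y, z) ∈ gluedClosure (prodMap T T') (N.prod N') := by
  choose g hg' hd using fun n : ℕ => hy ((1 / 2) ^ n) (by positivity)
  have hz : ∀ n, ∃ z, (g n, z) ∈ gluedSet (prodMap T T') := by
    intro n
    obtain ⟨p, x, hp, hx⟩ := hg' n
    -- The norm of `g n` is the required bound: on `p k` it is the norm of `T (x k)`, which
    -- dominates that of `T' (x k)`.
    obtain ⟨z, hz⟩ := hg p hp (fun k => T' (x k)) (N.toFun (g n)) (fun k => by
      refine (MetricFModule.smul_le_smul_left' (FAlgebra.idem_nonneg (hp.idem k))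
        (h (x k))).trans ?_
      rw [← N.idem_smul (hp.idem k), ← hx, N.idem_smul (hp.idem k)]
      exact MetricFModule.idem_smul_le (hp.idem k) (N.nonneg _))
    exact ⟨z, p, x, hp, fun k => Prod.ext (hx k) (hz k)⟩
  choose z hz using hz
  obtain ⟨z', hz'⟩ := hc z fun m n => by
    have h1 := norm_snd_le_of_mem_gluedSet h
      (sub_mem_gluedSet _ (hz m) (hz n))
    have h2 := N.dist_sub_le (g m) y (g n)
    rw [N.map_sub_rev (g m) y] at h2
    linarith [hd m, hd n, dist_mono _ _ (N'.nonneg _) h1]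
  refine ⟨z', fun ε hε => ?_⟩
  obtain ⟨n, hn⟩ := exists_pow_lt_of_lt_one (half_pos hε) (by norm_num : (1 / 2 : ℝ) < 1)
  refine ⟨_, hz n, ?_⟩
  have h1 := dist_add_zero_le (N.toFun (y - g n)) (N'.toFun (z' - z n))
  have h2 := hz' n
  rw [N'.map_sub_rev] at h2
  show dist (N.toFun (y - g n) + N'.toFun (z' - z n)) 0 < ε
  linarith [hd n]

/-- The universal property of the module generated by a seminorm: existence. -/
theorem exists_extension (h : ∀ x, N'.toFun (T' x) ≤ N.toFun (T x)) (hc : N'.IsComplete)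
    (hg : N'.HasGlueing) (hd : ∀ y, y ∈ gluedClosure T N) :
    ∃ Φ : E →ₗ[U] F, (∀ y, N'.toFun (Φ y) ≤ N.toFun y) ∧ ∀ x, Φ (T x) = T' x := by
  -- The closed graph is single-valued; since it is a submodule, linearity of `Φ` follows from this
  -- uniqueness.
  have uniq : ∀ y z z', (y, z) ∈ gluedClosure (prodMap T T') (N.prod N') →
      (y, z') ∈ gluedClosure (prodMap T T') (N.prod N') → z = z' := by
    intro y z z' h1 h2
    have h3 := norm_snd_le_of_mem_gluedClosure h (sub_mem h1 h2 : (y - y, z - z') ∈ _)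
    rw [sub_self, N.map_zero] at h3
    exact sub_eq_zero.1 ((N'.eq_zero_iff _).1 (le_antisymm h3 (N'.nonneg _)))
  choose Φ hΦ using fun y => exists_mem_gluedClosure h hc hg (hd y)
  refine ⟨⟨⟨Φ, fun y y' => ?_⟩, fun a y => ?_⟩, fun y => norm_snd_le_of_mem_gluedClosure h (hΦ y),
    fun x => ?_⟩
  · exact uniq _ _ _ (hΦ _) (add_mem (hΦ y) (hΦ y') : (y + y', Φ y + Φ y') ∈ _)
  · exact uniq _ _ _ (hΦ _) (Submodule.smul_mem _ a (hΦ y) : (a • y, a • Φ y) ∈ _)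
  · exact uniq _ _ _ (hΦ _) (map_mem_gluedClosure (prodMap T T') (N.prod N') x)

/-- The universal property of the module generated by a seminorm: uniqueness. -/
theorem extension_unique (hd : ∀ y, y ∈ gluedClosure T N) {Φ Ψ : E →ₗ[U] F}
    (hΦ : ∀ y, N'.toFun (Φ y) ≤ N.toFun y) (hΨ : ∀ y, N'.toFun (Ψ y) ≤ N.toFun y)
    (h : ∀ x, Φ (T x) = Ψ (T x)) : Φ = Ψ := by
  have hg : ∀ g ∈ gluedSet T, Φ g = Ψ g := by
    rintro g ⟨p, x, hp, hx⟩
    refine N'.eq_of_partition hp fun n => ?_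
    rw [← map_smul, ← map_smul, hx, map_smul, map_smul, h]
  ext y
  refine N'.eq_of_forall_dist_lt fun ε hε => ?_
  obtain ⟨g, hg', hd⟩ := hd y (ε / 2) (by linarith)
  have e : Φ y - Ψ y = Φ (y - g) - Ψ (y - g) := by
    rw [map_sub, map_sub, hg g hg']
    abel
  have h1 := N'.dist_sub_le (Φ (y - g)) 0 (Ψ (y - g))
  rw [sub_zero, zero_sub, N'.map_neg, ← e] at h1
  linarith [dist_mono _ _ (N'.nonneg _) (hΦ (y - g)), dist_mono _ _ (N'.nonneg _) (hΨ (y - g))]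

end Extension

end

/-! ### Glueing and completeness of the closure of the glued set -/

section Restriction

variable {U : Type*} {V : Type*} [CommRing U] [Algebra ℝ U] [Lattice U]
  [MetricSpace U] [MetricFAlgebra U] [AddCommGroup V] [Module ℝ V] [Lattice V] [MetricSpace V]
  [MetricRieszSpace V] [Module U V] [MetricFModule U V]
  {E : Type*} [AddCommGroup E] [Module U E]
  {𝒱 : Type*} [AddCommGroup 𝒱] [Module ℝ 𝒱]
  (N : PointwiseNorm U V E) (T : 𝒱 →ₛₗ[algebraMap ℝ U] E)

/-- Bounded sequences in the range of `T` can be glued. -/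
def GluesRange : Prop :=
  ∀ p : ℕ → U, IsPartition p → ∀ (x : ℕ → 𝒱) (b : V), (∀ n, p n • N.toFun (T (x n)) ≤ b) →
    ∃ y : E, ∀ n, p n • y = p n • T (x n)

variable {N T}

theorem GluesRange.exists_gluedSet (hG : GluesRange N T) {p : ℕ → U} (hp : IsPartition p)
    {g : ℕ → E} (hg : ∀ n, g n ∈ gluedSet T) {b : V} (hb : ∀ n, p n • N.toFun (g n) ≤ b) :
    ∃ y ∈ gluedSet T, ∀ n, p n • y = p n • g n := by
  choose q x hq hx using id hg
  obtain ⟨y, hy⟩ := hG _ (hp.refine hq) (fun k => x k.unpair.1 k.unpair.2) b (fun k => by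
    have h1 := congrArg N.toFun (hx k.unpair.1 k.unpair.2)
    rw [N.idem_smul ((hq _).idem _), N.idem_smul ((hq _).idem _)] at h1
    rw [mul_smul, ← h1, smul_comm]
    exact (MetricFModule.idem_smul_le ((hq _).idem _) (MetricFModule.smul_nonneg'
      (FAlgebra.idem_nonneg (hp.idem _)) (N.nonneg _))).trans (hb _))
  have h : ∀ n, p n • y = p n • g n := by
    intro n
    refine N.eq_of_partition (hq n) fun m => ?_
    have h1 := hy (Nat.pair n m)
    simp only [Nat.unpair_pair] at h1
    rw [smul_smul, mul_comm, h1, mul_smul, ← hx, smul_comm]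
  exact ⟨y, mem_gluedSet_of_partition hp hg h, h⟩

/-- This is where the compatibility of `V` with partitions enters: individually small errors on the
members of `p` have one common bound `s` that is small in distance. That bound also makes the
approximants glueable. -/
theorem GluesRange.exists_approx (hG : GluesRange N T) {p : ℕ → U} (hp : IsPartition p)
    {y : ℕ → E} (hy : ∀ n, y n ∈ gluedClosure T N) {b : V} (hb : ∀ n, p n • N.toFun (y n) ≤ b)
    {ε : ℝ} (hε : 0 < ε) :
    ∃ g ∈ gluedSet T, ∃ s : V, dist s 0 ≤ ε ∧ ∀ n, p n • N.toFun (y n - g) ≤ s := by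
  obtain ⟨δ, hδ, h⟩ := MetricFModule.exists_delta (V := V) p hp ε hε
  -- These tolerances sum to `δ`.
  choose g hg hd using fun n => hy n (δ / 2 / 2 ^ n) (by positivity)
  have hle : ∀ n, dist (p n • N.toFun (y n - g n)) 0 ≤ δ / 2 / 2 ^ n := fun n =>
    (dist_mono _ _ (MetricFModule.smul_nonneg' (FAlgebra.idem_nonneg (hp.idem n)) (N.nonneg _))
      (MetricFModule.idem_smul_le (hp.idem n) (N.nonneg _))).trans (hd n).le
  have hs : Summable fun n => dist (p n • N.toFun (y n - g n)) 0 :=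
    (summable_geometric_two' δ).of_nonneg_of_le (fun n => dist_nonneg) hle
  obtain ⟨s, hs1, hs2⟩ := h (fun n => N.toFun (y n - g n)) (fun n => N.nonneg _) hs
    ((hs.tsum_le_tsum hle (summable_geometric_two' δ)).trans (tsum_geometric_two' δ).le)
  have hs3 : ∀ n, p n • N.toFun (y n - g n) ≤ s := fun n => hs1.1 ⟨n, rfl⟩
  obtain ⟨a, ha, hag⟩ := hG.exists_gluedSet hp hg (b := b + s) (fun n => by
    have h1 := N.le_add_sub (g n) (y n)
    rw [N.map_sub_rev] at h1
    have h2 := MetricFModule.smul_le_smul_left' (FAlgebra.idem_nonneg (hp.idem n)) h1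
    rw [smul_add] at h2
    exact h2.trans (add_le_add (hb n) (hs3 n)))
  refine ⟨a, ha, s, hs2, fun n => ?_⟩
  rw [← N.idem_smul (hp.idem n), smul_sub, hag, ← smul_sub, N.idem_smul (hp.idem n)]
  exact hs3 n

theorem GluesRange.exists_gluedClosure (hG : GluesRange N T) (hN : N.IsComplete) {p : ℕ → U}
    (hp : IsPartition p) {y : ℕ → E} (hy : ∀ n, y n ∈ gluedClosure T N) {b : V}
    (hb : ∀ n, p n • N.toFun (y n) ≤ b) :
    ∃ z ∈ gluedClosure T N, ∀ n, p n • z = p n • y n := by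
  choose g hg s hs hle using fun k : ℕ => hG.exists_approx hp hy hb
    (ε := (1 / 2) ^ k) (by positivity)
  obtain ⟨z, hz⟩ := hN g fun k l => by
    -- On each `p n` both approximants are compared with the same `y n`.
    have h1 : N.toFun (g k - g l) ≤ s k + s l := by
      refine MetricFModule.le_of_partition hp fun n => ?_
      have h2 := MetricFModule.smul_le_smul_left' (FAlgebra.idem_nonneg (hp.idem n))
        (N.sub_le (g k) (y n) (g l))
      rw [N.map_sub_rev (g k) (y n), smul_add] at h2
      have h3 := MetricFModule.smul_le_smul_left' (FAlgebra.idem_nonneg (hp.idem n))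
        (h2.trans (add_le_add (hle k n) (hle l n)))
      rwa [smul_smul, hp.idem] at h3
    exact ((dist_mono _ _ (N.nonneg _) h1).trans (dist_add_zero_le _ _)).trans
      (add_le_add (hs k) (hs l))
  refine ⟨z, fun ε hε => ?_, fun n => N.eq_of_forall_dist_lt fun ε hε => ?_⟩
  · obtain ⟨k, hk⟩ := exists_pow_lt_of_lt_one hε (by norm_num : (1 / 2 : ℝ) < 1)
    exact ⟨g k, hg k, by rw [N.map_sub_rev]; exact (hz k).trans_lt hk⟩
  · obtain ⟨k, hk⟩ := exists_pow_lt_of_lt_one (half_pos hε) (by norm_num : (1 / 2 : ℝ) < 1)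
    have h0 := FAlgebra.idem_nonneg (hp.idem n)
    have h1 := N.dist_sub_le (p n • z) (p n • g k) (p n • y n)
    rw [← smul_sub (p n) z (g k), ← smul_sub (p n) (g k) (y n), N.idem_smul (hp.idem n),
      N.idem_smul (hp.idem n), N.map_sub_rev z (g k), N.map_sub_rev (g k) (y n)] at h1
    have h2 := dist_mono _ _ (MetricFModule.smul_nonneg' h0 (N.nonneg _))
      (MetricFModule.idem_smul_le (hp.idem n) (N.nonneg (g k - z)))
    have h3 := dist_mono _ _ (MetricFModule.smul_nonneg' h0 (N.nonneg _)) (hle k n)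
    linarith [hz k, hs k]

/-- The restriction of a pointwise norm to a submodule. -/
@[simps]
def PointwiseNorm.restrict (N : PointwiseNorm U V E) (M : Submodule U E) :
    PointwiseNorm U V M where
  toFun x := N.toFun x
  nonneg x := N.nonneg _
  eq_zero_iff x := by rw [N.eq_zero_iff, ZeroMemClass.coe_eq_zero]
  add_le x y := N.add_le _ _
  smul_eq a x := N.smul_eq a _

/-- The map `T`, with values in the closure of `gluedSet T`. -/
def toGluedClosure (N : PointwiseNorm U V E) (T : 𝒱 →ₛₗ[algebraMap ℝ U] E) :
    𝒱 →ₛₗ[algebraMap ℝ U] gluedClosure T N where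
  toFun x := ⟨T x, map_mem_gluedClosure T N x⟩
  map_add' x y := Subtype.ext (map_add T x y)
  map_smul' c x := Subtype.ext (map_smulₛₗ T c x)

theorem isComplete_restrict (hN : N.IsComplete) :
    (N.restrict (gluedClosure T N)).IsComplete := by
  intro x hx
  obtain ⟨y, hy⟩ := hN (fun n => x n) hx
  refine ⟨⟨y, N.closure_closure_subset _ fun ε hε => ?_⟩, hy⟩
  obtain ⟨k, hk⟩ := exists_pow_lt_of_lt_one hε (by norm_num : (1 / 2 : ℝ) < 1)
  exact ⟨x k, (x k).2, by rw [N.map_sub_rev]; exact (hy k).trans_lt hk⟩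

theorem GluesRange.hasGlueing_restrict (hG : GluesRange N T) (hN : N.IsComplete) :
    (N.restrict (gluedClosure T N)).HasGlueing := by
  intro p hp x b hb
  obtain ⟨z, hz, h⟩ := hG.exists_gluedClosure hN hp (fun n => (x n).2) hb
  exact ⟨⟨z, hz⟩, fun n => Subtype.ext (h n)⟩

theorem mem_gluedClosure_restrict (y : gluedClosure T N) :
    y ∈ gluedClosure (toGluedClosure N T) (N.restrict (gluedClosure T N)) := by
  intro ε hε
  obtain ⟨g, hg, hd⟩ := y.2 ε hε
  refine ⟨⟨g, N.subset_closure _ hg⟩, ?_, hd⟩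
  obtain ⟨p, x, hp, hx⟩ := hg
  exact ⟨p, x, hp, fun n => Subtype.ext (hx n)⟩

end Restriction

/-! ### Completion of a module with a pointwise seminorm -/

section Completion

variable {U : Type*} {V : Type*} [CommRing U] [Algebra ℝ U] [Lattice U]
  [MetricSpace U] [MetricFAlgebra U] [AddCommGroup V] [Module ℝ V] [Lattice V] [MetricSpace V]
  [MetricRieszSpace V] [Module U V] [MetricFModule U V]
  {E : Type w} [AddCommGroup E] [Module U E]

theorem PointwiseNorm.isComplete_of_completeSpace [MetricSpace E] [CompleteSpace E]
    (N : PointwiseNorm U V E) (h : ∀ x y, dist x y = dist (N.toFun (x - y)) 0) :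
    N.IsComplete := by
  intro x hx
  simp only [← h] at hx ⊢
  have ht : Filter.Tendsto (fun n : ℕ => (1 / 2 : ℝ) ^ n) Filter.atTop (nhds 0) :=
    tendsto_pow_atTop_nhds_zero_of_lt_one (by norm_num) (by norm_num)
  have hc : CauchySeq x := by
    refine cauchySeq_of_le_tendsto_0 (fun n => 2 * (1 / 2 : ℝ) ^ n) (fun n m k hn hm => ?_) ?_
    · have h1 : (1 / 2 : ℝ) ^ n ≤ (1 / 2) ^ k := pow_le_pow_of_le_one (by norm_num) (by norm_num) hn
      have h2 : (1 / 2 : ℝ) ^ m ≤ (1 / 2) ^ k := pow_le_pow_of_le_one (by norm_num) (by norm_num) hm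
      linarith [hx n m]
    · simpa using ht.const_mul 2
  obtain ⟨y, hy⟩ := cauchySeq_tendsto_of_complete hc
  refine ⟨y, fun n => ?_⟩
  refine le_of_tendsto_of_tendsto' (tendsto_const_nhds.dist hy) ?_ (fun m => hx n m)
  simpa using ht.const_add ((1 / 2 : ℝ) ^ n)

theorem PointwiseNorm.IsComplete.completeSpace [MetricSpace E]
    {N : PointwiseNorm U V E} (hN : N.IsComplete)
    (h : ∀ x y, dist x y = dist (N.toFun (x - y)) 0) : CompleteSpace E := by
  refine Metric.complete_of_convergent_controlled_sequences (fun n => (1 / 2 : ℝ) ^ n)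
    (fun n => by positivity) fun x hx => ?_
  obtain ⟨y, hy⟩ := hN x fun m n => by
    rw [← h]
    rcases le_total m n with hmn | hmn
    · exact (hx m m n le_rfl hmn).le.trans (le_add_of_nonneg_right (by positivity))
    · exact (hx n m n hmn le_rfl).le.trans (le_add_of_nonneg_left (by positivity))
  refine ⟨y, tendsto_iff_dist_tendsto_zero.2 (squeeze_zero (fun _ => dist_nonneg)
    (fun n => (h _ _).trans_le (hy n))
    (tendsto_pow_atTop_nhds_zero_of_lt_one (by norm_num) (by norm_num)))⟩

/-- A function that is multiplicative for real numbers and idempotents is so for all scalars. -/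
theorem smul_eq_of_idem_smul {f : E → V} (nonneg : ∀ x, 0 ≤ f x)
    (add_le : ∀ x y, f (x + y) ≤ f x + f y)
    (real_smul : ∀ (c : ℝ) x, f (algebraMap ℝ U c • x) = |c| • f x)
    (idem_smul : ∀ p : U, p * p = p → ∀ x, f (p • x) = p • f x)
    (bound : ∀ x, ∃ b : V, 0 ≤ b ∧ ∀ a : U, f (a • x) ≤ |a| • b) (a : U) (x : E) :
    f (a • x) = |a| • f x := by
  -- On each member of a suitable partition, `s` is a real number.
  have simple : ∀ s ∈ simpleElements U, f (s • x) = |s| • f x := by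
    intro s hs
    obtain ⟨p, c, hp, hc⟩ := exists_isPartition_of_mem_simpleElements hs
    refine MetricFModule.eq_of_partition hp fun n => ?_
    have e : p n * |s| = p n * algebraMap ℝ U |c n| := by
      have h0 := abs_of_nonneg (FAlgebra.idem_nonneg (hp.idem n))
      rw [← FAlgebra.abs_algebraMap]
      conv_lhs => rw [← h0, ← FAlgebra.abs_mul', hc, FAlgebra.abs_mul', h0]
    rw [← idem_smul _ (hp.idem n), smul_smul, hc, mul_smul, idem_smul _ (hp.idem n), real_smul,
      smul_smul, e, mul_smul, MetricFModule.algebraMap_smul]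
  obtain ⟨b, hb0, hb⟩ := bound x
  have hsub : ∀ s : U, f ((a - s) • x) = f ((s - a) • x) := fun s => by
    have h1 := real_smul (-1) ((a - s) • x)
    rw [abs_neg, abs_one, one_smul, _root_.map_neg, _root_.map_one, neg_one_smul, ← neg_smul,
      neg_sub] at h1
    exact h1.symm
  refine sub_eq_zero.1 (eq_of_forall_dist_le fun ε hε => ?_)
  -- The vector `b + f x` controls both errors: `b` the change of `f (a • x)`, and `f x` the change
  -- of `|a| • f x`.
  obtain ⟨s, hs, hd⟩ := exists_simple_dist_smul_lt a (b + f x) hε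
  refine le_trans ?_ hd.le
  rw [dist_abs ((a - s) • (b + f x)), MetricFModule.abs_smul,
    abs_of_nonneg (add_nonneg hb0 (nonneg x)), smul_add]
  refine dist_zero_le_of_abs_le ?_
  have h1 : |f (a • x) - f (s • x)| ≤ |a - s| • b := by
    refine abs_sub_le_of_le ?_ ?_
    · refine le_trans ?_ (add_le_add_right (hb (a - s)) _)
      simpa [← add_smul] using add_le (s • x) ((a - s) • x)
    · refine le_trans ?_ (add_le_add_right (hb (a - s)) _)
      rw [hsub]
      simpa [← add_smul] using add_le (a • x) ((s - a) • x)
  have h2 : |(|s| • f x - |a| • f x)| ≤ |a - s| • f x := by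
    rw [← sub_smul, MetricFModule.abs_smul, abs_of_nonneg (nonneg x)]
    refine MetricFModule.smul_le_smul_right' ?_ (nonneg x)
    rw [abs_sub_comm a s]
    exact abs_abs_sub_abs_le s a
  have e : f (a • x) - |a| • f x = (f (a • x) - f (s • x)) + (|s| • f x - |a| • f x) := by
    rw [simple s hs]
    abel
  rw [e]
  exact (abs_add_le _ _).trans (add_le_add h1 h2)

/-- The completion of a module for a pointwise seminorm. -/
theorem exists_completion (f : E → V) (nonneg : ∀ x, 0 ≤ f x)
    (add_le : ∀ x y, f (x + y) ≤ f x + f y) (smul_eq : ∀ (a : U) x, f (a • x) = |a| • f x) :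
    ∃ (E' : Type w) (_ : AddCommGroup E') (_ : Module U E') (N : PointwiseNorm U V E')
      (ι : E →ₗ[U] E'), N.IsComplete ∧ ∀ x, N.toFun (ι x) = f x := by
  have f_zero : f 0 = 0 := by simpa using smul_eq 0 0
  have f_neg : ∀ x, f (-x) = f x := fun x => by
    have := smul_eq (-1) x
    rwa [neg_one_smul, abs_neg, abs_of_nonneg FAlgebra.one_nonneg, one_smul] at this
  let sn : AddGroupSeminorm E :=
    { toFun := fun x => dist (f x) 0
      map_zero' := by rw [f_zero, dist_self]
      add_le' := fun x y => (dist_mono _ _ (nonneg _) (add_le x y)).trans (dist_add_zero_le _ _)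
      neg' := fun x => by rw [f_neg] }
  let _ : SeminormedAddCommGroup E := sn.toSeminormedAddCommGroup
  have hnorm : ∀ x : E, ‖x‖ = dist (f x) 0 := fun x => rfl
  have : UniformContinuousConstSMul U E := ⟨fun a => by
    refine uniformContinuous_of_continuousAt_zero (DistribSMul.toAddMonoidHom E a) ?_
    refine Metric.continuousAt_iff.2 fun ε hε => ?_
    obtain ⟨δ, hδ, h⟩ := exists_dist_smul_lt (V := V) |a| hε
    refine ⟨δ, hδ, fun {x} hx => ?_⟩
    rw [_root_.map_zero, dist_zero_right, hnorm]
    rw [dist_zero_right, hnorm] at hx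
    show dist (f (a • x)) 0 < ε
    rw [smul_eq]
    exact h _ hx⟩
  have hf : UniformContinuous f := by
    refine (LipschitzWith.of_dist_le_mul (K := 1) fun x y => ?_).uniformContinuous
    rw [NNReal.coe_one, one_mul, dist_eq_norm, hnorm, MetricRieszSpace.dist_eq_dist_sub]
    refine dist_zero_le_of_abs_le (abs_sub_le_of_le ?_ ?_)
    · simpa using add_le y (x - y)
    · rw [← f_neg (x - y), neg_sub]
      simpa using add_le x (y - x)
  -- The seminorm is 1-Lipschitz, so it extends; its properties pass to the completion because order
  -- relations in `V` are closed.
  let g : UniformSpace.Completion E → V := UniformSpace.Completion.extension f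
  have hg : Continuous g := UniformSpace.Completion.continuous_extension
  have hgf : ∀ x : E, g x = f x := fun x => UniformSpace.Completion.extension_coe hf x
  have hdist : ∀ x, dist (g x) 0 = ‖x‖ := fun x => by
    induction x using UniformSpace.Completion.induction_on with
    | hp => exact isClosed_eq (hg.dist continuous_const) continuous_norm
    | ih x => rw [hgf, UniformSpace.Completion.norm_coe, hnorm]
  let N : PointwiseNorm U V (UniformSpace.Completion E) :=
    { toFun := g
      nonneg := fun x => by
        induction x using UniformSpace.Completion.induction_on with
        | hp => exact isClosed_le continuous_const hg
        | ih x => rw [hgf]; exact nonneg x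
      eq_zero_iff := fun x => by
        rw [← norm_eq_zero, ← hdist, dist_eq_zero]
      add_le := fun x y => by
        induction x, y using UniformSpace.Completion.induction_on₂ with
        | hp =>
          exact isClosed_le (hg.comp (continuous_fst.add continuous_snd))
            ((hg.comp continuous_fst).add (hg.comp continuous_snd))
        | ih x y => rw [← UniformSpace.Completion.coe_add, hgf, hgf, hgf]; exact add_le x y
      smul_eq := fun a x => by
        induction x using UniformSpace.Completion.induction_on with
        | hp =>
          exact isClosed_eq (hg.comp (continuous_const_smul a))
            ((MetricFModule.continuous_smul (U := U) (V := V)).comp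
              (continuous_const.prodMk hg))
        | ih x => rw [← UniformSpace.Completion.coe_smul, hgf, hgf, smul_eq] }
  refine ⟨UniformSpace.Completion E, inferInstance, inferInstance, N,
    ⟨⟨(↑), fun x y => UniformSpace.Completion.coe_add x y⟩,
      fun a x => UniformSpace.Completion.coe_smul a x⟩, ?_, hgf⟩
  refine N.isComplete_of_completeSpace fun x y => ?_
  rw [dist_eq_norm, ← hdist]

end Completion

/-! ### The module of summable families -/

namespace SummableFamily

variable {U : Type*} {V : Type*} [CommRing U] [Algebra ℝ U] [Lattice U]
  [MetricSpace U] [MetricFAlgebra U] [AddCommGroup V] [Module ℝ V] [Lattice V] [MetricSpace V]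
  [MetricRieszSpace V] [Module U V] [MetricFModule U V]
  {𝒱 : Type*} [AddCommGroup 𝒱] [Module ℝ 𝒱] {I : Type*}

/-- The partial sums of `∑ |t i| • φ i`. -/
def partialSum (φ : I → V) (t : I → U) (s : Finset I) : V := ∑ i ∈ s, |t i| • φ i

theorem partialSum_add_le {φ : I → V} (hφ : ∀ i, 0 ≤ φ i) (t t' : I → U) (s : Finset I) :
    partialSum φ (t + t') s ≤ partialSum φ t s + partialSum φ t' s := by
  rw [partialSum, partialSum, partialSum, ← Finset.sum_add_distrib]
  refine Finset.sum_le_sum fun i _ => ?_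
  rw [← add_smul]
  exact MetricFModule.smul_le_smul_right' (abs_add_le _ _) (hφ i)

theorem partialSum_smul (φ : I → V) (a : U) (t : I → U) (s : Finset I) :
    partialSum φ (a • t) s = |a| • partialSum φ t s := by
  rw [partialSum, partialSum, Finset.smul_sum]
  refine Finset.sum_congr rfl fun i _ => ?_
  rw [Pi.smul_apply, smul_eq_mul, FAlgebra.abs_mul', mul_smul]

theorem partialSum_mono {φ : I → V} (hφ : ∀ i, 0 ≤ φ i) (t : I → U) {s s' : Finset I}
    (h : s ⊆ s') : partialSum φ t s ≤ partialSum φ t s' :=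
  Finset.sum_le_sum_of_subset_of_nonneg h fun i _ _ =>
    MetricFModule.smul_nonneg' (abs_nonneg _) (hφ i)

variable (U) in
/-- The families `t` with countable support and `∑ |t i| • φ i` bounded. -/
def families {φ : I → V} (hφ : ∀ i, 0 ≤ φ i) : Submodule U (I → U) where
  carrier := {t | (Function.support t).Countable ∧ ∃ b, ∀ s, partialSum φ t s ≤ b}
  zero_mem' := ⟨by simp, 0, fun s => by simp [partialSum]⟩
  add_mem' := by
    rintro t t' ⟨h1, b, h2⟩ ⟨h1', b', h2'⟩
    exact ⟨(h1.union h1').mono (Function.support_add t t'), b + b', fun s =>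
      (partialSum_add_le hφ t t' s).trans (add_le_add (h2 s) (h2' s))⟩
  smul_mem' := by
    rintro a t ⟨h1, b, h2⟩
    refine ⟨h1.mono (Function.support_const_smul_subset a t), |a| • b, fun s => ?_⟩
    rw [partialSum_smul]
    exact MetricFModule.smul_le_smul_left' (abs_nonneg a) (h2 s)

variable {φ : I → V} {hφ : ∀ i, 0 ≤ φ i}

/-- Countable support leaves only countably many distinct partial sums, as σ-completeness requires.
-/
theorem exists_isLUB (t : families U hφ) :
    ∃ b, IsLUB (Set.range (partialSum φ (t : I → U))) b := by
  classical
  obtain ⟨h1, b, h2⟩ := t.2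
  refine sigma_complete.exists_sup _ (Set.range_nonempty _) ?_
    ⟨b, by rintro _ ⟨s, rfl⟩; exact h2 s⟩
  have := h1.to_subtype
  refine (Set.countable_range fun s : Finset (Function.support (t : I → U)) =>
    partialSum φ (t : I → U) (s.map (Function.Embedding.subtype _))).mono ?_
  rintro _ ⟨s, rfl⟩
  refine ⟨s.subtype _, ?_⟩
  simp only [partialSum]
  rw [Finset.subtype_map]
  refine Finset.sum_subset (Finset.filter_subset _ _) fun i hi hi' => ?_
  have : (t : I → U) i = 0 := by
    by_contra h
    exact hi' (Finset.mem_filter.2 ⟨hi, h⟩)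
  rw [this, abs_zero, zero_smul]

/-- The sum `∑ |t i| • φ i`. -/
noncomputable def total (t : families U hφ) : V := (exists_isLUB t).choose

theorem isLUB_total (t : families U hφ) :
    IsLUB (Set.range (partialSum φ (t : I → U))) (total t) := (exists_isLUB t).choose_spec

theorem partialSum_le_total (t : families U hφ) (s : Finset I) :
    partialSum φ (t : I → U) s ≤ total t := (isLUB_total t).1 ⟨s, rfl⟩

theorem total_le {t : families U hφ} {b : V} (h : ∀ s, partialSum φ (t : I → U) s ≤ b) :
    total t ≤ b := (isLUB_total t).2 (by rintro _ ⟨s, rfl⟩; exact h s)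

theorem total_nonneg (t : families U hφ) : 0 ≤ total t := by
  simpa [partialSum] using partialSum_le_total t ∅

theorem total_add_le (t t' : families U hφ) : total (t + t') ≤ total t + total t' :=
  total_le fun s => (partialSum_add_le hφ _ _ s).trans
    (add_le_add (partialSum_le_total t s) (partialSum_le_total t' s))

theorem total_smul_le (a : U) (t : families U hφ) : total (a • t) ≤ |a| • total t :=
  total_le fun s => by
    rw [Submodule.coe_smul, partialSum_smul]
    exact MetricFModule.smul_le_smul_left' (abs_nonneg a) (partialSum_le_total t s)

theorem total_zero : total (0 : families U hφ) = 0 :=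
  le_antisymm (total_le fun s => by simp [partialSum]) (total_nonneg _)

theorem total_idem_smul {p : U} (hp : p * p = p) (t : families U hφ) :
    total (p • t) = p • total t := by
  refine (isLUB_total (p • t)).unique ?_
  have h := MetricFModule.isLUB_idem_smul hp (isLUB_total t)
  have e : ∀ s, partialSum φ ((p • t : families U hφ) : I → U) s =
      p • partialSum φ (t : I → U) s := fun s => by
    rw [Submodule.coe_smul, partialSum_smul, abs_of_nonneg (FAlgebra.idem_nonneg hp)]
  rwa [← funext e] at h

variable (U hφ) in
/-- The finitely supported real families. -/
noncomputable def realFamily : (I →₀ ℝ) →ₛₗ[algebraMap ℝ U] families U hφ where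
  toFun q := ⟨fun i => algebraMap ℝ U (q i), by
    classical
    have hsub : (Function.support fun i => algebraMap ℝ U (q i)) ⊆ (q.support : Set I) := by
      intro i hi
      rw [Finset.mem_coe, Finsupp.mem_support_iff]
      intro h
      exact hi (by simp [h])
    refine ⟨q.support.countable_toSet.mono hsub,
      partialSum φ (fun i => algebraMap ℝ U (q i)) q.support, fun s => ?_⟩
    refine (partialSum_mono hφ _ (Finset.subset_union_left (s₂ := q.support))).trans (le_of_eq ?_)
    refine (Finset.sum_subset Finset.subset_union_right fun i _ hi => ?_).symm
    simp [Finsupp.notMem_support_iff.1 hi]⟩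
  map_add' q q' := Subtype.ext (funext fun i => by simp)
  map_smul' c q := Subtype.ext (funext fun i => map_mul (algebraMap ℝ U) c (q i))

theorem realFamily_apply (q : I →₀ ℝ) (i : I) :
    (realFamily U hφ q : I → U) i = algebraMap ℝ U (q i) := rfl

theorem sum_le_total_realFamily (q : I →₀ ℝ) (s : Finset I) :
    ∑ i ∈ s, |q i| • φ i ≤ total (realFamily U hφ q) := by
  refine le_trans (le_of_eq ?_) (partialSum_le_total _ s)
  refine Finset.sum_congr rfl fun i _ => ?_
  rw [realFamily_apply, FAlgebra.abs_algebraMap, MetricFModule.algebraMap_smul]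

end SummableFamily

namespace IsSymmetricSublinear

variable {V : Type*} [AddCommGroup V] [Module ℝ V] [Lattice V] [MetricSpace V]
  [MetricRieszSpace V] {𝒱 : Type*} [AddCommGroup 𝒱] [Module ℝ 𝒱]

theorem map_zero {V : Type*} [AddCommGroup V] [Module ℝ V] [Lattice V] {ψ : 𝒱 → V}
    (hψ : IsSymmetricSublinear ψ) : ψ 0 = 0 := by
  simpa using hψ.smul 0 0 le_rfl

theorem map_smul {V : Type*} [AddCommGroup V] [Module ℝ V] [Lattice V] {ψ : 𝒱 → V}
    (hψ : IsSymmetricSublinear ψ) (c : ℝ) (x : 𝒱) : ψ (c • x) = |c| • ψ x := by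
  rcases le_total 0 c with h | h
  · rw [hψ.smul c x h, abs_of_nonneg h]
  · rw [abs_of_nonpos h, ← hψ.smul _ _ (neg_nonneg.2 h), neg_smul, hψ.neg]

theorem map_linearCombination_le {ψ : 𝒱 → V} (hψ : IsSymmetricSublinear ψ) {I : Type*}
    (e : I → 𝒱) (q : I →₀ ℝ) {s : Finset I} (hs : q.support ⊆ s) :
    ψ (Finsupp.linearCombination ℝ e q) ≤ ∑ i ∈ s, |q i| • ψ (e i) := by
  rw [Finsupp.linearCombination_apply, Finsupp.sum_of_support_subset _ hs _ (by simp)]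
  refine (Finset.le_sum_of_subadditive ψ hψ.map_zero.le hψ.add_le _ _).trans (le_of_eq ?_)
  exact Finset.sum_congr rfl fun i _ => hψ.map_smul _ _

end IsSymmetricSublinear

/-! ### The seminorm on families induced by `ψ` -/

namespace SummableFamily

variable {U : Type*} {V : Type*} [CommRing U] [Algebra ℝ U] [Lattice U]
  [MetricSpace U] [MetricFAlgebra U] [AddCommGroup V] [Module ℝ V] [Lattice V] [MetricSpace V]
  [MetricRieszSpace V] [Module U V] [MetricFModule U V]
  {𝒱 : Type*} [AddCommGroup 𝒱] [Module ℝ 𝒱] {I : Type*}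

variable (U) in
/-- The families `t` in `U` for which `∑ |t i| • ψ (e i)` makes sense. -/
abbrev Fam {ψ : 𝒱 → V} (hψ : IsSymmetricSublinear ψ) (e : I → 𝒱) : Submodule U (I → U) :=
  families U (φ := fun i => ψ (e i)) fun i => hψ.nonneg (e i)

variable {ψ : 𝒱 → V} {hψ : IsSymmetricSublinear ψ} {e : I → 𝒱}

variable (U hψ e) in
/-- The finitely supported real families. -/
noncomputable abbrev real : (I →₀ ℝ) →ₛₗ[algebraMap ℝ U] Fam U hψ e :=
  realFamily U fun i => hψ.nonneg (e i)

/-- The upper bound for the seminorm of `t` obtained by comparing it with the real family `q`. -/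
noncomputable def upper (t : Fam U hψ e) (q : I →₀ ℝ) : V :=
  ψ (Finsupp.linearCombination ℝ e q) + total (t - real U hψ e q)

theorem upper_nonneg (t : Fam U hψ e) (q : I →₀ ℝ) : 0 ≤ upper t q :=
  add_nonneg (hψ.nonneg _) (total_nonneg _)

/-- Replacing `q` by `q'` raises the `ψ` term by at most `∑ |q' i - q i| • ψ (e i)`. Where `t`
vanishes so does `q'`, and the other term drops by exactly the same amount; elsewhere each term
costs at most `ε` per index, whence the factor `2`. -/
theorem upper_le_of_close (t : Fam U hψ e) (q q' : I →₀ ℝ) {ε : ℝ} (hε : 0 ≤ ε)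
    (hsupp : q'.support ⊆ q.support) (hout : ∀ i, (t : I → U) i = 0 → q' i = 0)
    (hclose : ∀ i, (t : I → U) i ≠ 0 → |q i - q' i| ≤ ε) :
    upper t q' ≤ upper t q + ε • ((2 : ℝ) • ∑ i ∈ q.support, ψ (e i)) := by
  classical
  have hd : (q' - q).support ⊆ q.support := by
    intro i hi
    by_contra h
    have h' : i ∉ q'.support := fun h1 => h (hsupp h1)
    rw [Finsupp.mem_support_iff, Finsupp.sub_apply, Finsupp.notMem_support_iff.1 h,
      Finsupp.notMem_support_iff.1 h', sub_self] at hi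
    exact hi rfl
  have h1 : ψ (Finsupp.linearCombination ℝ e q') ≤ ψ (Finsupp.linearCombination ℝ e q) +
      ∑ i ∈ q.support, |(q' - q) i| • ψ (e i) := by
    refine le_trans ?_ (add_le_add_right (hψ.map_linearCombination_le e _ hd) _)
    simpa using hψ.add_le (Finsupp.linearCombination ℝ e q)
      (Finsupp.linearCombination ℝ e (q' - q))
  have h2 : total (t - real U hψ e q') ≤ total (t - real U hψ e q) +
      ε • ((2 : ℝ) • ∑ i ∈ q.support, ψ (e i)) -
        ∑ i ∈ q.support, |(q' - q) i| • ψ (e i) := by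
    refine total_le fun s => ?_
    refine (partialSum_mono (fun i => hψ.nonneg (e i)) _
      (Finset.subset_union_left (s₂ := q.support))).trans ?_
    have hq : ∀ i ∉ q.support, q i = 0 ∧ q' i = 0 := fun i hi =>
      ⟨Finsupp.notMem_support_iff.1 hi, Finsupp.notMem_support_iff.1 fun h => hi (hsupp h)⟩
    have e1 : ε • ((2 : ℝ) • ∑ i ∈ q.support, ψ (e i)) =
        ∑ i ∈ s ∪ q.support, (if i ∈ q.support then ε * 2 else 0) • ψ (e i) := by
      rw [smul_smul, Finset.smul_sum]
      refine Finset.sum_subset_zero_on_sdiff Finset.subset_union_right (fun i hi => ?_)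
        (fun i hi => ?_)
      · rw [if_neg (Finset.mem_sdiff.1 hi).2, zero_smul]
      · rw [if_pos hi]
    have e2 : ∑ i ∈ q.support, |(q' - q) i| • ψ (e i) =
        ∑ i ∈ s ∪ q.support, |(q' - q) i| • ψ (e i) := by
      refine Finset.sum_subset Finset.subset_union_right fun i _ hi => ?_
      rw [Finsupp.notMem_support_iff.1 fun h => hi (hd h), abs_zero, zero_smul]
    rw [e1, e2, le_sub_iff_add_le]
    refine le_trans ?_ (add_le_add_left (partialSum_le_total _ (s ∪ q.support)) _)
    simp only [partialSum]
    rw [← Finset.sum_add_distrib, ← Finset.sum_add_distrib]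
    refine Finset.sum_le_sum fun i _ => ?_
    rw [← MetricFModule.algebraMap_smul (U := U), ← MetricFModule.algebraMap_smul (U := U),
      ← add_smul, ← add_smul]
    refine MetricFModule.smul_le_smul_right' ?_ (hψ.nonneg _)
    show |(t : I → U) i - algebraMap ℝ U (q' i)| + algebraMap ℝ U |q' i - q i| ≤
      |(t : I → U) i - algebraMap ℝ U (q i)| + algebraMap ℝ U (if i ∈ q.support then ε * 2 else 0)
    by_cases ht : (t : I → U) i = 0
    · rw [ht, hout i ht, map_zero, sub_zero, abs_zero, zero_add, zero_sub, zero_sub, abs_neg,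
        abs_neg, FAlgebra.abs_algebraMap]
      refine le_add_of_nonneg_right (FAlgebra.algebraMap_nonneg ?_)
      split_ifs
      · positivity
      · exact le_rfl
    · have h3 : |(t : I → U) i - algebraMap ℝ U (q' i)| ≤
          |(t : I → U) i - algebraMap ℝ U (q i)| + algebraMap ℝ U |q' i - q i| := by
        rw [← FAlgebra.abs_algebraMap, map_sub, abs_sub_comm (algebraMap ℝ U (q' i))]
        simpa using abs_add_le ((t : I → U) i - algebraMap ℝ U (q i))
          (algebraMap ℝ U (q i) - algebraMap ℝ U (q' i))
      refine (add_le_add_left h3 _).trans ?_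
      rw [add_assoc, ← map_add]
      refine add_le_add_right ?_ _
      rw [← sub_nonneg, ← map_sub]
      refine FAlgebra.algebraMap_nonneg ?_
      split_ifs with hi
      · have := hclose i ht
        rw [abs_sub_comm] at this
        linarith
      · rw [(hq i hi).1, (hq i hi).2]
        simp
  calc upper t q' ≤ _ := add_le_add h1 h2
    _ = upper t q + ε • ((2 : ℝ) • ∑ i ∈ q.support, ψ (e i)) := by
      rw [upper]
      abel

theorem exists_isGLB_upper (t : Fam U hψ e) : ∃ b, IsGLB (Set.range (upper t)) b := by
  classical
  have hc : Countable (Function.support (t : I → U)) := t.2.1.to_subtype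
  -- The infimum is taken over this countable set of rational families on the support of `t`; each
  -- real `q` is then handled by rounding it on that support and dropping the rest.
  let J : (Function.support (t : I → U) →₀ ℚ) → (I →₀ ℝ) := fun r =>
    (r.mapRange (fun c : ℚ => (c : ℝ)) Rat.cast_zero).mapDomain Subtype.val
  have hJ : ∀ r (i : Function.support (t : I → U)), J r i = r i := fun r i => by
    simp only [J]
    rw [Finsupp.mapDomain_apply Subtype.val_injective, Finsupp.mapRange_apply]
  have hJ' : ∀ r (i : I), (t : I → U) i = 0 → J r i = 0 := fun r i hi =>
    Finsupp.mapDomain_of_notMem_range _ _ (by simpa using hi)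
  obtain ⟨b, hb⟩ := sigma_complete.exists_inf (Set.range fun r => upper t (J r))
    (Set.range_nonempty _) (Set.countable_range _)
    ⟨0, by rintro _ ⟨r, rfl⟩; exact upper_nonneg _ _⟩
  refine ⟨b, ?_, fun c hc => hb.2 (by rintro _ ⟨r, rfl⟩; exact hc ⟨_, rfl⟩)⟩
  rintro _ ⟨q, rfl⟩
  refine MetricFModule.le_of_forall_le_add_smul U
    (c := (2 : ℝ) • ∑ i ∈ q.support, ψ (e i)) fun ε hε => ?_
  choose r hr using fun i => exists_rat_near (q i) hε
  let r' : Function.support (t : I → U) →₀ ℚ :=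
    Finsupp.onFinset (q.support.subtype _) (fun i => if (i : I) ∈ q.support then r i else 0)
      fun i hi => by
        rw [Finset.mem_subtype]
        by_contra h
        exact hi (if_neg h)
  have hr' : ∀ i (hi : (t : I → U) i ≠ 0), J r' i = if i ∈ q.support then (r i : ℝ) else 0 := by
    intro i hi
    rw [hJ r' ⟨i, hi⟩]
    show ((if i ∈ q.support then r i else 0 : ℚ) : ℝ) = _
    split_ifs <;> simp
  refine (hb.1 ⟨r', rfl⟩).trans (upper_le_of_close t q (J r') hε.le ?_ (hJ' r') ?_)
  · intro i hi
    by_contra h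
    refine Finsupp.mem_support_iff.1 hi ?_
    by_cases ht : (t : I → U) i = 0
    · exact hJ' _ _ ht
    · rw [hr' i ht, if_neg h]
  · intro i hi
    rw [hr' i hi]
    split_ifs with h
    · exact (hr i).le
    · rw [Finsupp.notMem_support_iff.1 h, sub_zero, abs_zero]
      exact hε.le

/-- The largest pointwise seminorm that is at most `ψ (e i)` on the `i`-th unit vector and agrees
with `ψ` on real families. -/
noncomputable def seminorm (t : Fam U hψ e) : V := (exists_isGLB_upper t).choose

theorem isGLB_seminorm (t : Fam U hψ e) : IsGLB (Set.range (upper t)) (seminorm t) :=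
  (exists_isGLB_upper t).choose_spec

theorem seminorm_le_upper (t : Fam U hψ e) (q : I →₀ ℝ) : seminorm t ≤ upper t q :=
  (isGLB_seminorm t).1 ⟨q, rfl⟩

theorem le_seminorm {t : Fam U hψ e} {b : V} (h : ∀ q, b ≤ upper t q) : b ≤ seminorm t :=
  (isGLB_seminorm t).2 (by rintro _ ⟨q, rfl⟩; exact h q)

theorem seminorm_nonneg (t : Fam U hψ e) : 0 ≤ seminorm t := le_seminorm (upper_nonneg t)

theorem seminorm_le_total (t : Fam U hψ e) : seminorm t ≤ total t := by
  simpa [upper, hψ.map_zero] using seminorm_le_upper t 0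

theorem seminorm_zero : seminorm (0 : Fam U hψ e) = 0 :=
  le_antisymm ((seminorm_le_total 0).trans total_zero.le) (seminorm_nonneg _)

theorem seminorm_add_le (t t' : Fam U hψ e) : seminorm (t + t') ≤ seminorm t + seminorm t' := by
  have h : ∀ q q', seminorm (t + t') ≤ upper t q + upper t' q' := fun q q' => by
    refine (seminorm_le_upper _ (q + q')).trans ?_
    rw [upper, upper, upper, add_add_add_comm, map_add, map_add, add_sub_add_comm]
    exact add_le_add (hψ.add_le _ _) (total_add_le _ _)
  rw [← sub_le_iff_le_add]
  refine le_seminorm fun q => ?_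
  rw [sub_le_iff_le_add, ← sub_le_iff_le_add']
  refine le_seminorm fun q' => ?_
  rw [sub_le_iff_le_add']
  exact h q q'

theorem seminorm_real_smul_le (c : ℝ) (t : Fam U hψ e) :
    seminorm (algebraMap ℝ U c • t) ≤ |c| • seminorm t := by
  by_cases hc : c = 0
  · rw [hc, map_zero, zero_smul, abs_zero, zero_smul, seminorm_zero]
  have hc' : 0 < |c| := abs_pos.2 hc
  have h : |c|⁻¹ • seminorm (algebraMap ℝ U c • t) ≤ seminorm t := by
    refine le_seminorm fun q => ?_
    have h1 : seminorm (algebraMap ℝ U c • t) ≤ |c| • upper t q := by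
      refine (seminorm_le_upper _ (c • q)).trans ?_
      have e1 : algebraMap ℝ U c • t - real U hψ e (c • q) =
          algebraMap ℝ U c • (t - real U hψ e q) := by
        rw [map_smulₛₗ]
        exact (smul_sub _ _ _).symm
      rw [upper, upper, e1, _root_.map_smul, hψ.map_smul, smul_add]
      refine add_le_add_right ((total_smul_le _ _).trans ?_) _
      rw [FAlgebra.abs_algebraMap, MetricFModule.algebraMap_smul]
    have h2 := smul_le_smul_of_nonneg_left h1 (inv_nonneg.2 hc'.le)
    rwa [inv_smul_smul₀ hc'.ne'] at h2
  have h2 := smul_le_smul_of_nonneg_left h hc'.le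
  rwa [smul_inv_smul₀ hc'.ne'] at h2

theorem seminorm_real_smul (c : ℝ) (t : Fam U hψ e) :
    seminorm (algebraMap ℝ U c • t) = |c| • seminorm t := by
  refine le_antisymm (seminorm_real_smul_le c t) ?_
  by_cases hc : c = 0
  · rw [hc, abs_zero, zero_smul]
    exact seminorm_nonneg _
  have hc' : 0 < |c| := abs_pos.2 hc
  have h := seminorm_real_smul_le c⁻¹ (algebraMap ℝ U c • t)
  rw [smul_smul, ← map_mul, inv_mul_cancel₀ hc, map_one, one_smul, abs_inv] at h
  have h2 := smul_le_smul_of_nonneg_left h hc'.le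
  rwa [smul_inv_smul₀ hc'.ne'] at h2

/-- Multiplication by `p` commutes with the infimum, and `p • upper t q` depends on `t` only through
`p • t`. -/
theorem idem_smul_seminorm_congr {p : U} (hp : p * p = p) {t t' : Fam U hψ e}
    (h : p • t = p • t') : p • seminorm t = p • seminorm t' := by
  have h1 := MetricFModule.isGLB_idem_smul hp (isGLB_seminorm t)
  have h2 := MetricFModule.isGLB_idem_smul hp (isGLB_seminorm t')
  have e1 : ∀ q, p • upper t q = p • upper t' q := fun q => by
    rw [upper, upper, smul_add, smul_add, ← total_idem_smul hp, ← total_idem_smul hp, smul_sub,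
      smul_sub, h]
  simp only [e1] at h1
  exact h1.unique h2

theorem seminorm_idem_smul {p : U} (hp : p * p = p) (t : Fam U hψ e) :
    seminorm (p • t) = p • seminorm t := by
  have hp' : (1 - p) * (1 - p) = 1 - p := by linear_combination hp
  have h1 : p • seminorm (p • t) = p • seminorm t :=
    idem_smul_seminorm_congr hp (by rw [smul_smul, hp])
  have h2 : (1 - p) • seminorm (p • t) = (1 - p) • seminorm (0 : Fam U hψ e) :=
    idem_smul_seminorm_congr hp' (by
      rw [smul_smul, smul_zero, show (1 - p) * p = 0 by linear_combination -hp, zero_smul])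
  rw [seminorm_zero, smul_zero, sub_smul, one_smul, h1] at h2
  exact sub_eq_zero.1 h2

theorem seminorm_smul (a : U) (t : Fam U hψ e) : seminorm (a • t) = |a| • seminorm t := by
  refine smul_eq_of_idem_smul (E := Fam U hψ e) (f := seminorm) ?_ ?_ ?_ ?_ ?_ a t
  · exact seminorm_nonneg
  · exact seminorm_add_le
  · exact seminorm_real_smul
  · exact fun _ hp t => seminorm_idem_smul hp t
  · exact fun t => ⟨total t, total_nonneg t, fun a =>
      (seminorm_le_total _).trans (total_smul_le a t)⟩

theorem seminorm_real (q : I →₀ ℝ) :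
    seminorm (real U hψ e q) = ψ (Finsupp.linearCombination ℝ e q) := by
  refine le_antisymm ?_ (le_seminorm fun q' => ?_)
  · refine (seminorm_le_upper _ q).trans ?_
    rw [upper, sub_self, total_zero, add_zero]
  -- Each competitor `q'` is bounded below through subadditivity of `ψ` applied to `q = q' + (q -
  -- q')`.
  · rw [upper, ← map_sub]
    refine le_trans ?_ (add_le_add_right ((hψ.map_linearCombination_le e (q - q') subset_rfl).trans
      (sum_le_total_realFamily _ _)) _)
    simpa using hψ.add_le (Finsupp.linearCombination ℝ e q')
      (Finsupp.linearCombination ℝ e (q - q'))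

end SummableFamily

/-! ### The ambient complete module -/

section Existence

variable {U V : Type u} [CommRing U] [Algebra ℝ U] [Lattice U]
  [MetricSpace U] [MetricFAlgebra U] [AddCommGroup V] [Module ℝ V] [Lattice V] [MetricSpace V]
  [MetricRieszSpace V] [Module U V] [MetricFModule U V]
  {𝒱 : Type v} [AddCommGroup 𝒱] [Module ℝ 𝒱]

open SummableFamily

open Classical in
/-- The family representing the glueing of the vectors `x n` along `p`. -/
noncomputable def glueFamily (p : ℕ → U) (x : ℕ → 𝒱) : 𝒱 × ℕ → U :=
  -- The index in `ℕ` keeps repeated values of `x` apart, so that each coordinate is a single `p n`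
  -- or `0`.
  fun i => if i.1 = x i.2 then p i.2 else 0

theorem mul_glueFamily {p : ℕ → U} (hp : IsPartition p) (x : ℕ → 𝒱) (n : ℕ) (i : 𝒱 × ℕ) :
    p n * glueFamily p x i = p n * algebraMap ℝ U (Finsupp.single (x n, n) 1 i) := by
  classical
  rw [glueFamily, Finsupp.single_apply]
  by_cases h : (x n, n) = i
  · subst h
    simp [hp.idem]
  · rw [if_neg h, map_zero, mul_zero]
    split_ifs with h'
    · refine hp.disjoint _ _ fun hn => h ?_
      subst hn
      exact Prod.ext h'.symm rfl
    · exact mul_zero _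

theorem glueFamily_mem {ψ : 𝒱 → V} (hψ : IsSymmetricSublinear ψ) {p : ℕ → U}
    (hp : IsPartition p) (x : ℕ → 𝒱) {b : V} (hb : ∀ n, p n • ψ (x n) ≤ b) :
    glueFamily p x ∈ Fam U hψ (Prod.fst : 𝒱 × ℕ → 𝒱) := by
  classical
  refine ⟨(Set.countable_range fun n => (x n, n)).mono ?_, b, fun s => ?_⟩
  · intro i hi
    rw [Function.mem_support, glueFamily] at hi
    refine ⟨i.2, Prod.ext ?_ rfl⟩
    by_contra h
    exact hi (if_neg fun h' => h h'.symm)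
  -- On `p n` at most the one coordinate `(x n, n)` survives, so a partial sum is there at most `p n
  -- • ψ (x n)`.
  · refine MetricFModule.le_of_partition hp fun n => ?_
    have h0 := FAlgebra.idem_nonneg (hp.idem n)
    have e1 : p n • partialSum (fun i : 𝒱 × ℕ => ψ i.1) (glueFamily p x) s =
        ∑ i ∈ s, if (x n, n) = i then p n • ψ (x n) else 0 := by
      rw [partialSum, Finset.smul_sum]
      refine Finset.sum_congr rfl fun i _ => ?_
      have e2 : p n * |glueFamily p x i| = |p n * glueFamily p x i| := by
        rw [FAlgebra.abs_mul', abs_of_nonneg h0]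
      rw [smul_smul, e2, mul_glueFamily hp, Finsupp.single_apply]
      by_cases h : (x n, n) = i
      · rw [if_pos h, if_pos h, map_one, mul_one, abs_of_nonneg h0, ← h]
      · rw [if_neg h, if_neg h, map_zero, mul_zero, abs_zero, zero_smul]
    have h1 : p n • partialSum (fun i : 𝒱 × ℕ => ψ i.1) (glueFamily p x) s ≤ p n • ψ (x n) := by
      rw [e1, Finset.sum_ite_eq]
      split_ifs
      · exact le_rfl
      · exact MetricFModule.smul_nonneg' h0 (hψ.nonneg _)
    have h2 := MetricFModule.smul_le_smul_left' h0 (h1.trans (hb n))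
    rwa [smul_smul, hp.idem] at h2

/-- A complete module with a linear map `T` such that `|T x| = ψ x`, whose range can be glued. -/
theorem exists_ambient {ψ : 𝒱 → V} (hψ : IsSymmetricSublinear ψ) :
    ∃ (E : Type (max u v)) (_ : AddCommGroup E) (_ : Module U E) (N : PointwiseNorm U V E)
      (T : 𝒱 →ₛₗ[algebraMap ℝ U] E), N.IsComplete ∧ (∀ x, N.toFun (T x) = ψ x) ∧
        GluesRange N T := by
  obtain ⟨E, _, _, N, ι, hN, hι⟩ := exists_completion (U := U) (V := V)
    (E := Fam U hψ (Prod.fst : 𝒱 × ℕ → 𝒱)) seminorm seminorm_nonneg seminorm_add_le seminorm_smul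
  let R : (𝒱 × ℕ →₀ ℝ) → E := fun q => ι (real U hψ Prod.fst q)
  -- Real families with equal linear combinations differ by one of seminorm `ψ 0 = 0`. This gives
  -- both the linearity of `T` and its independence of the index in `ℕ`.
  have hR : ∀ q q', Finsupp.linearCombination ℝ (Prod.fst : 𝒱 × ℕ → 𝒱) q =
      Finsupp.linearCombination ℝ Prod.fst q' → R q = R q' := by
    intro q q' h
    rw [← sub_eq_zero, ← N.eq_zero_iff]
    simp only [R]
    rw [← map_sub, ← map_sub, hι, seminorm_real, map_sub, h, sub_self, hψ.map_zero]
  let T : 𝒱 →ₛₗ[algebraMap ℝ U] E :=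
    { toFun := fun x => R (Finsupp.single (x, 0) 1)
      map_add' := fun x y => by
        simp only [R]
        rw [← map_add, ← map_add]
        exact hR _ _ (by simp)
      map_smul' := fun c x => by
        simp only [R]
        rw [← map_smul, ← map_smulₛₗ]
        exact hR _ _ (by simp) }
  have hT : ∀ x n, T x = R (Finsupp.single (x, n) 1) := fun x n => hR _ _ (by simp)
  have hTn : ∀ x, N.toFun (T x) = ψ x := fun x => by
    show N.toFun (ι _) = _
    rw [hι, seminorm_real]
    simp
  refine ⟨E, _, _, N, T, hN, hTn, fun p hp x b hb => ?_⟩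
  simp only [hTn] at hb
  refine ⟨ι ⟨glueFamily p x, glueFamily_mem hψ hp x hb⟩, fun n => ?_⟩
  rw [hT (x n) n]
  simp only [R]
  rw [← map_smul, ← map_smul]
  exact congrArg ι (Subtype.ext (funext fun i => mul_glueFamily hp x n i))

end Existence

/-! ### Banach modules -/

section BanachModule

variable {𝒰 : Type u} [CommRing 𝒰] [Algebra ℝ 𝒰] [Lattice 𝒰] [LocalisableFAlgebra 𝒰]
  {S : MetricFStructure 𝒰}

/-- The pointwise norm underlying a `VNorm`. -/
@[simps]
def VNorm.toPointwiseNorm {M : Type w} [AddCommGroup M] [Module S.U M] (N : VNorm S M) :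
    PointwiseNorm S.U S.V M where
  toFun := N.toFun
  nonneg := N.nonneg
  eq_zero_iff := N.eq_zero_iff
  add_le := N.add_le
  smul_eq a x := Subtype.ext (N.smul_eq a x)

theorem VNorm.hasGlueing {M : Type w} [AddCommGroup M] [Module S.U M] (N : VNorm S M) :
    N.toPointwiseNorm.HasGlueing := by
  intro p hp x b hb
  refine N.glueing p hp.isCountablePartition x ⟨⟨b, ?_⟩, ⟨0, ?_⟩⟩
  · rintro _ ⟨n, rfl⟩
    exact (N.toPointwiseNorm.idem_smul (hp.idem n) (x n)).trans_le (hb n)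
  · rintro _ ⟨n, rfl⟩
    exact N.nonneg _

theorem BanMod.isComplete (M : BanMod.{u, w} S) : M.norm.toPointwiseNorm.IsComplete :=
  haveI := M.complete
  M.norm.toPointwiseNorm.isComplete_of_completeSpace fun _ _ => rfl

/-- The Banach module given by a complete pointwise norm with the glueing property. -/
def BanMod.ofPointwiseNorm {M : Type w} [AddCommGroup M] [Module S.U M]
    (N : PointwiseNorm S.U S.V M) (hN : N.IsComplete) (hG : N.HasGlueing) : BanMod.{u, w} S where
  carrier := M
  norm :=
    { toFun := N.toFun
      nonneg := N.nonneg
      eq_zero_iff := N.eq_zero_iff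
      add_le := N.add_le
      smul_eq := fun a x => congrArg Subtype.val (N.smul_eq a x)
      glueing := fun p hp x hb => by
        obtain ⟨b, hb⟩ := hb.1
        refine hG p hp.isPartition x b fun n => ?_
        rw [← N.idem_smul (hp.isPartition.idem n)]
        exact hb ⟨n, rfl⟩ }
  complete := by
    refine @PointwiseNorm.IsComplete.completeSpace _ _ _ _ _ _ _ _ _ _ _ _ _ _ _ _ _
      (VNorm.metricSpace _) _ hN fun _ _ => rfl

variable {𝒱 : Type v} [AddCommGroup 𝒱] [Module ℝ 𝒱]

/-- The order-boundedness required in `glued` is automatic once the glued element exists: its own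
norm is a bound. -/
theorem BanMod.glued_range_eq (M : BanMod.{u, w} S) (T : 𝒱 →ₛₗ[algebraMap ℝ S.U] M) :
    M.glued (Set.range T) = gluedSet T := by
  ext y
  constructor
  · rintro ⟨p, x, hp, hx, -, h⟩
    choose z hz using hx
    exact ⟨p, z, hp.isPartition, fun n => by rw [h, hz]⟩
  · rintro ⟨p, x, hp, h⟩
    refine ⟨p, fun n => T (x n), hp.isCountablePartition, fun n => ⟨x n, rfl⟩,
      ⟨⟨M.pnorm y, ?_⟩, ⟨0, ?_⟩⟩, h⟩
    · rintro _ ⟨n, rfl⟩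
      show M.pnorm (p n • T (x n)) ≤ _
      rw [← h]
      exact (M.norm.toPointwiseNorm.idem_smul (hp.idem n) y).trans_le
        (MetricFModule.idem_smul_le (hp.idem n) (M.norm.nonneg y))
    · rintro _ ⟨n, rfl⟩
      exact M.norm.nonneg _

theorem BanMod.dense_glued_iff (M : BanMod.{u, w} S) (T : 𝒱 →ₛₗ[algebraMap ℝ S.U] M) :
    Dense (M.glued (Set.range T)) ↔ ∀ y, y ∈ gluedClosure T M.norm.toPointwiseNorm := by
  rw [M.glued_range_eq]
  rw [Metric.dense_iff]
  refine forall_congr' fun y => forall_congr' fun ε => forall_congr' fun _ => ?_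
  refine exists_congr fun g => ?_
  rw [Set.mem_inter_iff, Metric.mem_ball', and_comm]
  exact Iff.rfl

theorem CPsi.exists_isGenerated {ψ : 𝒱 → S.V} (hψ : IsSymmetricSublinear ψ) :
    ∃ X : CPsi.{u, v, max u v} S ψ, X.IsGenerated := by
  obtain ⟨E, _, _, N, T, hN, hT, hG⟩ := exists_ambient (U := S.U) hψ
  let M : BanMod.{u, max u v} S := BanMod.ofPointwiseNorm (N.restrict (gluedClosure T N))
    (isComplete_restrict hN) (hG.hasGlueing_restrict hN)
  let X : CPsi.{u, v, max u v} S ψ :=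
    { M := M
      T := toGluedClosure N T
      pnorm_le := fun x => (hT x).le }
  exact ⟨X, hT, (M.dense_glued_iff _).2 mem_gluedClosure_restrict⟩

theorem CPsi.IsGenerated.nonempty_isInitial {ψ : 𝒱 → S.V} {X : CPsi.{u, v, w} S ψ}
    (hX : X.IsGenerated) : Nonempty (Limits.IsInitial X) := by
  have hd := (X.M.dense_glued_iff X.T).1 hX.dense
  have h : ∀ Y : CPsi.{u, v, w} S ψ, ∃ f : X ⟶ Y, ∀ g : X ⟶ Y, g = f := by
    intro Y
    obtain ⟨Φ, h1, h2⟩ := exists_extension (N := X.M.norm.toPointwiseNorm)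
      (N' := Y.M.norm.toPointwiseNorm) (T := X.T) (T' := Y.T)
      (fun x => (Y.pnorm_le x).trans (hX.pnorm_eq x).ge) Y.M.isComplete Y.M.norm.hasGlueing hd
    let f : CPsi.Hom X Y := ⟨(⟨Φ, h1⟩ : BanMod.Hom X.M Y.M), h2⟩
    refine ⟨f, fun g => ?_⟩
    refine CPsi.Hom.ext (BanMod.Hom.ext ?_)
    exact extension_unique (N := X.M.norm.toPointwiseNorm) (N' := Y.M.norm.toPointwiseNorm) hd
      (BanMod.Hom.pnorm_le (CPsi.Hom.hom g)) h1 fun x => (CPsi.Hom.comm g x).trans (h2 x).symm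
  choose f hf using h
  exact ⟨Limits.IsInitial.ofUniqueHom f fun Y g => hf Y g⟩

/-- Generated objects may be transported along a linear equivalence. -/
theorem CPsi.IsGenerated.comp {𝒲 : Type*} [AddCommGroup 𝒲] [Module ℝ 𝒲] {ψ : 𝒱 → S.V}
    (L : 𝒲 ≃ₗ[ℝ] 𝒱) {X : CPsi S fun y => ψ (L y)} (hX : X.IsGenerated) :
    CPsi.IsGenerated (ψ := ψ) ⟨X.M, X.T.comp L.symm.toLinearMap, fun x => by
      simpa using X.pnorm_le (L.symm x)⟩ where
  pnorm_eq x := by simpa using hX.pnorm_eq (L.symm x)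
  dense := by
    have : Set.range (X.T.comp L.symm.toLinearMap) = Set.range X.T := by
      rw [LinearMap.coe_comp]
      exact L.symm.surjective.range_comp X.T
    show Dense (X.M.glued (Set.range (X.T.comp L.symm.toLinearMap)))
    rw [this]
    exact hX.dense

end BanachModule

theorem mainTheorem2 {𝒰 : Type u} [CommRing 𝒰] [Algebra ℝ 𝒰] [Lattice 𝒰]
    [LocalisableFAlgebra 𝒰] (S : MetricFStructure 𝒰) {𝒱 : Type v} [AddCommGroup 𝒱]
    [Module ℝ 𝒱] (ψ : 𝒱 → S.V) (hψ : IsSymmetricSublinear ψ) :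
    (∃ X : CPsi.{u, v, max u v w} S ψ, X.IsGenerated) ∧
      ∀ X : CPsi.{u, v, max u v w} S ψ, X.IsGenerated → Nonempty (Limits.IsInitial X) := by
  refine ⟨?_, fun X hX => hX.nonempty_isInitial⟩
  -- Lifting `𝒱` moves the constructed module from universe `max u v` to `max u v w`.
  let L : ULift.{w} 𝒱 ≃ₗ[ℝ] 𝒱 := ULift.moduleEquiv
  have hL : IsSymmetricSublinear fun y => ψ (L y) :=
    { nonneg := fun y => hψ.nonneg _
      smul := fun c y hc => by rw [map_smul, hψ.smul c _ hc]
      add_le := fun y z => by rw [map_add]; exact hψ.add_le _ _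
      neg := fun y => by rw [map_neg, hψ.neg] }
  obtain ⟨X, hX⟩ := CPsi.exists_isGenerated hL
  exact ⟨_, hX.comp L⟩
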